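/- Let $(\mathcal A, D, \mathcal H)$ be a spectral triple: $\mathcal A$ is a unital complex algebra acting on the Hilbert space $\mathcal H$ by bounded operators (the unit acting as the identity), $D$ is a self-adjoint operator on $\mathcal H$ with compact resolvent, and for every $a\in\mathcal A$ the operator $a$ maps the domain of $D$ into itself and $[D,a]$ is bounded. Assume that $0$ is not an eigenvalue of $D$. Let $\mu_n(D)$ be the $n$-th eigenvalue of $|D|$, in non-decreasing order and counted with multiplicity (with $\mu_n(D)=\infty$ if $|D|$ has too few eigenvalues), that is, $\mu_n(D)=\mu_n(D^{-1})^{-1}$, where $\mu_n(D^{-1})$ is the non-increasing sequence of the singular values of $D^{-1}$. Define the box dimension $$d_B=\Bigl(\liminf_{n\to\infty}\frac{\log\mu_n(D)}{\log n}\Bigr)^{-1}\in[0,\infty].$$ Suppose that $d_B$ is finite and non-zero, and let $\mathcal I\subset\mathcal B(\mathcal H)$ be the two-sided ideal generated by $|D|^{-d_B}$. A singular trace on $\mathcal I$ is a linear functional $\tau:\mathcal I\to\mathbb C$ which is non-negative on positive operators, satisfies $\tau(bx)=\tau(xb)$ for $b\in\mathcal B(\mathcal H)$ and $x\in\mathcal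 I$, and vanishes on finite rank operators. Then: 1. $|D|^{-d_B}$ is singularly traceable: there is a singular trace $\tau$ on $\mathcal I$ with $\tau(|D|^{-d_B})=1$; in particular $\tau$ is non-trivial. 2. For every singular trace $\tau$ on $\mathcal I$ with $\tau(|D|^{-d_B})=1$, the functional $\varphi(a)=\tau(a|D|^{-d_B})$ is a (non-trivial) trace state on $\mathcal A$: it is linear, $\varphi(1)=1$, $\varphi(ab)=\varphi(ba)$ for all $a,b\in\mathcal A$, and $\varphi(a)\ge 0$ whenever $a\in\mathcal A$ acts as a positive operator (in particular $\varphi(a^*a)\ge0$ if $\mathcal A$ is a $*$-algebra acting by a $*$-representation). -/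

import Mathlib

open Filter
open scoped ComplexOrder ENNReal

namespace BoxDim

noncomputable section

section Defs

variable {H : Type*} [NormedAddCommGroup H] [InnerProductSpace ℂ H]

/-- `R` is a bounded, everywhere defined two-sided inverse of the (possibly unbounded) operator
`D - z`. -/
def IsResolventAt (D : H →ₗ.[ℂ] H) (z : ℂ) (R : H →L[ℂ] H) : Prop :=
  (∀ x : H, ∃ h : R x ∈ D.domain, D ⟨R x, h⟩ - z • R x = x) ∧
    ∀ x : D.domain, R (D x - z • (x : H)) = x

theorem IsResolventAt.unique {D : H →ₗ.[ℂ] H} {z : ℂ} {R S : H →L[ℂ] H}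
    (hR : IsResolventAt D z R) (hS : IsResolventAt D z S) : R = S := by
  ext x
  obtain ⟨h, hx⟩ := hR.1 x
  have h2 := hS.2 ⟨R x, h⟩
  simp only at h2
  rw [hx] at h2
  exact h2.symm

/-- `D` has compact resolvent: `(D - z)⁻¹` exists and is compact for some complex number `z`. -/
def HasCompactResolvent (D : H →ₗ.[ℂ] H) : Prop :=
  ∃ (z : ℂ) (R : H →L[ℂ] H), IsResolventAt D z R ∧ IsCompactOperator R

open Classical in
/-- The bounded inverse `D⁻¹` of `D` (with the value `0` if `D` has no bounded inverse). For a
self-adjoint `D` with compact resolvent and trivial kernel the inverse exists, see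
`isResolventAt_inverseOp`. -/
def inverseOp (D : H →ₗ.[ℂ] H) : H →L[ℂ] H :=
  if h : ∃ R : H →L[ℂ] H, IsResolventAt D 0 R then h.choose else 0

theorem exists_inverse [CompleteSpace H] {D : H →ₗ.[ℂ] H} (hD : HasCompactResolvent D)
    (hker : ∀ x : D.domain, D x = 0 → x = 0) :
    ∃ R : H →L[ℂ] H, IsResolventAt D 0 R := by
  obtain ⟨z, R, hR, hc⟩ := hD
  by_cases hz : z = 0
  · subst hz; exact ⟨R, hR⟩
  have hz' : -z⁻¹ ≠ 0 := neg_ne_zero.2 (inv_ne_zero hz)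
  -- by the Fredholm alternative `1 + z R` is invertible, and `D⁻¹ = R (1 + z R)⁻¹`
  rcases hc.hasEigenvalue_or_mem_resolventSet hz' with he | hr
  · exfalso
    obtain ⟨v, hv⟩ := he.exists_hasEigenvector
    have hRv : R v = -z⁻¹ • v := hv.apply_eq_smul
    obtain ⟨h, hx⟩ := hR.1 v
    have h0 : (⟨R v, h⟩ : D.domain) = 0 := by
      apply hker
      rw [sub_eq_iff_eq_add] at hx
      rw [hx, hRv, smul_smul, mul_neg, mul_inv_cancel₀ hz, neg_one_smul, add_neg_cancel]
    have h1 : R v = 0 := congrArg Subtype.val h0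
    rw [hRv] at h1
    exact hv.2 ((smul_eq_zero.1 h1).resolve_left hz')
  · obtain ⟨u, hu⟩ := spectrum.mem_resolventSet_iff.1 hr
    have hu1 : ∀ x, -z⁻¹ • u⁻¹.1 x - R (u⁻¹.1 x) = x := fun x => by
      have h := congrArg (fun f : H →L[ℂ] H => f x) u.mul_inv
      rw [hu] at h
      simpa [Algebra.algebraMap_eq_smul_one] using h
    have hu2 : ∀ x, u⁻¹.1 (-z⁻¹ • x - R x) = x := fun x => by
      have h := congrArg (fun f : H →L[ℂ] H => f x) u.inv_mul
      rw [hu] at h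
      simpa [Algebra.algebraMap_eq_smul_one] using h
    refine ⟨R * (-z⁻¹ • u⁻¹.1), fun x => ?_, fun x => ?_⟩
    · obtain ⟨h, hx⟩ := hR.1 (-z⁻¹ • u⁻¹.1 x)
      refine ⟨h, ?_⟩
      rw [zero_smul, sub_zero]
      rw [sub_eq_iff_eq_add] at hx
      refine Eq.trans hx ?_
      rw [map_smul, smul_smul, mul_neg, mul_inv_cancel₀ hz, neg_one_smul, ← sub_eq_add_neg, hu1]
    · have hy := hR.2 x
      have h : D x = -z • (-z⁻¹ • (D x - z • (x : H)) - R (D x - z • (x : H))) := by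
        rw [hy, smul_sub, smul_smul, neg_mul_neg, mul_inv_cancel₀ hz, one_smul, neg_smul,
          sub_neg_eq_add, sub_add_cancel]
      rw [zero_smul, sub_zero]
      change R (-z⁻¹ • u⁻¹.1 (D x)) = x
      rw [h, map_smul, map_smul, hu2, map_smul, smul_smul, neg_mul_neg, inv_mul_cancel₀ hz, one_smul, hy]

/-- If `D` has compact resolvent and `0` is not an eigenvalue of `D`, then `inverseOp D` really is
the inverse of `D`. -/
theorem isResolventAt_inverseOp [CompleteSpace H] {D : H →ₗ.[ℂ] H} (hD : HasCompactResolvent D)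
    (hker : ∀ x : D.domain, D x = 0 → x = 0) : IsResolventAt D 0 (inverseOp D) := by
  have h := exists_inverse hD hker
  rw [inverseOp, dif_pos h]
  exact h.choose_spec

/-- The operator `|D|^{-d} = |D⁻¹|^d`, through the continuous functional calculus. -/
def absNegPow [CompleteSpace H] (D : H →ₗ.[ℂ] H) (d : ℝ) : H →L[ℂ] H :=
  CFC.abs (inverseOp D) ^ d

/-- The distribution function `λ_a(s) = tr e_{|a|}(s, ∞)` of a compact operator `a`, for `s ≥ 0`:
the number of eigenvalues of `|a|` that are larger than `s`, counted with multiplicity, i.e. the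
dimension of the span of the eigenspaces of `|a|` for the eigenvalues `t > s`. -/
def distribution [CompleteSpace H] (a : H →L[ℂ] H) (s : ℝ) : ℕ∞ :=
  Cardinal.toENat (Module.rank ℂ
    ↥(⨆ t : Set.Ioi s, Module.End.eigenspace ((CFC.abs a : H →L[ℂ] H) : H →ₗ[ℂ] H) ((t : ℝ) : ℂ)))

/-- The non-increasing rearrangement `μ_n(a) = inf {s ≥ 0 : λ_a(s) ≤ n}` of a compact operator
`a`, i.e. the sequence (indexed from `n = 0`) of its singular values in non-increasing order,
counted with multiplicity. -/
def mu [CompleteSpace H] (a : H →L[ℂ] H) (n : ℕ) : ℝ :=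
  sInf {s : ℝ | 0 ≤ s ∧ distribution a s ≤ n}

/-- The non-decreasing sequence `μ_n(D) = μ_n(D⁻¹)⁻¹` (indexed from `n = 0`) of the eigenvalues of
`|D|`, counted with multiplicity; it is `∞` when `|D|` has at most `n` eigenvalues. -/
def eigenvalueSeq [CompleteSpace H] (D : H →ₗ.[ℂ] H) (n : ℕ) : ℝ≥0∞ :=
  (ENNReal.ofReal (mu (inverseOp D) n))⁻¹

/-- The box dimension `(liminf_n log μ_n(D) / log n)⁻¹`, with values in `[0, ∞]`. -/
def boxDimension [CompleteSpace H] (D : H →ₗ.[ℂ] H) : ℝ≥0∞ :=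
  (liminf (fun n : ℕ => ENNReal.log (eigenvalueSeq D n) / ENNReal.log (n : ℝ≥0∞))
    atTop).toENNReal⁻¹

/-- `(A, D, H)` is a spectral triple: the unital algebra `A` acts on `H` by bounded operators
through `π`, `D` is a self-adjoint operator on `H` (in particular densely defined), all commutators
`[D, π a]` are bounded, and `D` has compact resolvent. -/
structure IsSpectralTriple [CompleteSpace H] {A : Type*} [Ring A] [Algebra ℂ A] (π : A →ₐ[ℂ] (H →L[ℂ] H))
    (D : H →ₗ.[ℂ] H) : Prop where
  selfAdjoint : IsSelfAdjoint D
  bounded_commutator : ∀ a : A, ∃ C : ℝ, ∀ x : D.domain,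
    ∃ h : π a x ∈ D.domain, ‖D ⟨π a x, h⟩ - π a (D x)‖ ≤ C * ‖(x : H)‖
  compact_resolvent : HasCompactResolvent D

/-- The two-sided ideal of `B(H)` generated by `T`: the finite sums of operators `x T y`. -/
def idealGen (T : H →L[ℂ] H) : Submodule ℂ (H →L[ℂ] H) :=
  Submodule.span ℂ {z | ∃ x y : H →L[ℂ] H, z = x * T * y}

theorem mul_mem_idealGen {T z : H →L[ℂ] H} (b : H →L[ℂ] H) (hz : z ∈ idealGen T) :
    b * z ∈ idealGen T := by
  induction hz using Submodule.span_induction with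
  | mem w hw =>
    obtain ⟨x, y, rfl⟩ := hw
    exact Submodule.subset_span ⟨b * x, y, by simp only [mul_assoc]⟩
  | zero => rw [mul_zero]; exact Submodule.zero_mem _
  | add u v _ _ hu hv => rw [mul_add]; exact Submodule.add_mem _ hu hv
  | smul c u _ hu => rw [mul_smul_comm]; exact Submodule.smul_mem _ c hu

theorem mem_idealGen_mul {T z : H →L[ℂ] H} (b : H →L[ℂ] H) (hz : z ∈ idealGen T) :
    z * b ∈ idealGen T := by
  induction hz using Submodule.span_induction with
  | mem w hw =>
    obtain ⟨x, y, rfl⟩ := hw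
    exact Submodule.subset_span ⟨x, y * b, by simp only [mul_assoc]⟩
  | zero => rw [zero_mul]; exact Submodule.zero_mem _
  | add u v _ _ hu hv => rw [add_mul]; exact Submodule.add_mem _ hu hv
  | smul c u _ hu => rw [smul_mul_assoc]; exact Submodule.smul_mem _ c hu

theorem self_mem_idealGen (T : H →L[ℂ] H) : T ∈ idealGen T :=
  Submodule.subset_span ⟨1, 1, by simp⟩

/-- A singular trace on the ideal generated by `T`: a positive linear functional on the ideal with
the trace property `τ (b x) = τ (x b)` for `b` in `B(H)` and `x` in the ideal, which vanishes on the
operators of finite rank. -/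
structure IsSingularTrace (T : H →L[ℂ] H) (τ : idealGen T →ₗ[ℂ] ℂ) : Prop where
  nonneg : ∀ x : idealGen T, (x : H →L[ℂ] H).IsPositive → 0 ≤ τ x
  trace : ∀ (b : H →L[ℂ] H) (x : idealGen T),
    τ ⟨b * x, mul_mem_idealGen b x.2⟩ = τ ⟨x * b, mem_idealGen_mul b x.2⟩
  singular : ∀ x : idealGen T,
    FiniteDimensional ℂ (LinearMap.range ((x : H →L[ℂ] H) : H →ₗ[ℂ] H)) → τ x = 0

section Functional

variable {A : Type*} [Ring A] [Algebra ℂ A]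

/-- The functional `a ↦ τ (a T)` on the algebra `A` acting on `H` through `π`. -/
def traceFunctional (π : A →ₐ[ℂ] (H →L[ℂ] H)) (T : H →L[ℂ] H) (τ : idealGen T →ₗ[ℂ] ℂ) :
    A →ₗ[ℂ] ℂ where
  toFun a := τ ⟨π a * T, mul_mem_idealGen (π a) (self_mem_idealGen T)⟩
  map_add' a b := by
    rw [← map_add]
    congr 1
    ext1
    simp [add_mul]
  map_smul' c a := by
    rw [RingHom.id_apply, ← map_smul]
    congr 1
    ext1
    simp

/-- A trace state on the unital algebra `A` acting on `H` through `π`: a linear functional that is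
normalised (in particular not zero), tracial, and non-negative on every element that acts as a
positive operator. If `A` is a `*`-algebra and `π` a `*`-representation, these elements include
all `star a * a`. -/
structure IsTraceState (π : A →ₐ[ℂ] (H →L[ℂ] H)) (φ : A →ₗ[ℂ] ℂ) : Prop where
  map_one : φ 1 = 1
  nonneg : ∀ a : A, (π a).IsPositive → 0 ≤ φ a
  trace : ∀ a b : A, φ (a * b) = φ (b * a)

end Functional

end Defs

end

end BoxDim

open scoped InnerProductSpace

namespace BoxDim

/-! Let `T` be `|D|^{-d}` with `d` the box dimension, and let `t n` be its eigenvalues in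
non-increasing order. The definition of `d` says only that `n * t n` is eventually at most `n ^ ε`
and frequently at least `n ^ (-ε)`, for every `ε > 0`.

Existence. These bounds produce, for every `C`, a window `[n, m)` whose eigenvalue sum exceeds `C *
(n * t n + m * t m)` (`exists_sum_Ico_gt`); otherwise the partial sums would grow, or the tails
decay, at a definite power rate. For an operator `∑ c • u * T * v`, sum the diagonal terms `t j * ⟪e
j, v (u (e j))⟫` over such windows, divide by the window sum, and take a limit along an ultrafilter.
Up to an error `O(n * t n + m * t m)`, negligible after the division, the sum over a window is an
honest trace of the operator over a finite orthonormal set, which may be taken orthogonal to any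
given finite dimensional space. So the limit depends on the operator only, is positive and kills
finite rank; cyclicity is visible in the formula (`exists_isSingularTrace_of_sum_Ico_gt`).

Trace property. For a singular trace `τ`, the functional `ψ x = τ (x T)` on all of `B(H)` is
positive, hence norm continuous, and vanishes on finite rank operators, hence on their norm limits.
It is cyclic up to a twist: `T * v = w * T` gives `ψ (a * w) = ψ (v * a)`. Cut the spectrum of `D⁻¹`
into geometric scales of ratio `θ < 1`. If `[D, x]` is bounded, the blocks of `x` joining
non-adjacent scales decay geometrically (`norm_diagProj_block_le`), so removing them changes `x` by
something `ψ` does not see (`exists_band_approx`). On what remains, conjugation by `T` is close to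
the identity, with an error controlled by `θ ^ (-3 * d) - 1` (`norm_apply_commutator_le_of_band`).
Letting `θ → 1` gives `ψ (a * x) = ψ (x * a)` for every bounded `a`
(`apply_mul_comm_of_hasBoundedCommutator`). -/

/-! ### Sequences: windows whose sum dominates their boundary terms. -/

theorem one_add_inv_rpow_le {δ : ℝ} (h0 : 0 ≤ δ) (h1 : δ ≤ 1) {n : ℕ} (hn : 1 ≤ n) :
    ((n : ℝ) + 1) ^ δ ≤ (n : ℝ) ^ δ * (1 + δ / n) := by
  have hn' : (0 : ℝ) < n := by exact_mod_cast hn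
  have h : ((n : ℝ) + 1) = n * (1 + 1 / n) := by field_simp
  rw [h, Real.mul_rpow hn'.le (by positivity)]
  gcongr
  have := rpow_one_add_le_one_add_mul_self (s := 1 / (n : ℝ))
    (by have : 0 ≤ 1 / (n : ℝ) := by positivity
        linarith) h0 h1
  rwa [mul_one_div] at this

/-- If the series diverged, its partial sums `F` would eventually satisfy `δ * F m ≤ m * t m` with
`δ = 1 / (2 * C)`, a discrete form of `F' ≥ δ F / m`. Then `F m`, and with it `m * t m`, would be at
least a multiple of `m ^ δ`, against the upper bound. -/
theorem not_summable_of_sum_Ico_le {t : ℕ → ℝ} (ht : ∀ n, 0 < t n)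
    (hup : ∀ ε : ℝ, 0 < ε → ∀ᶠ n : ℕ in atTop, n * t n ≤ (n : ℝ) ^ ε) {C : ℝ} (hC : 1 ≤ C)
    (h : ∀ n m : ℕ, 1 ≤ n → n < m → ∑ j ∈ Finset.Ico n m, t j ≤ C * (n * t n + m * t m)) :
    Summable t := by
  by_contra hs
  have hC0 : 0 < C := by linarith
  set δ : ℝ := 1 / (2 * C) with hδ
  have hδ0 : 0 < δ := by positivity
  have hδ1 : δ ≤ 1 := by
    rw [hδ, div_le_one (by positivity)]; linarith
  set F : ℕ → ℝ := fun m => ∑ j ∈ Finset.Ico 1 m, t j with hF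
  have hFtop : Tendsto F atTop atTop := by
    have h1 := (not_summable_iff_tendsto_nat_atTop_of_nonneg (fun n => (ht n).le)).1 hs
    have h2 : ∀ᶠ m in atTop, F m = ∑ j ∈ Finset.range m, t j + (-t 0) := by
      filter_upwards [eventually_ge_atTop 1] with m hm
      rw [hF]
      simp only
      rw [Finset.sum_Ico_eq_sub _ hm, Finset.sum_range_one, sub_eq_add_neg]
    exact (tendsto_congr' h2).2 (tendsto_atTop_add_const_right _ _ h1)
  -- Beyond `M` the boundary term `C * t 1` is at most half of `F m`; this is where the factor 2 in
  -- `δ` comes from.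
  obtain ⟨M, hM⟩ := eventually_atTop.1
    ((hFtop.eventually_ge_atTop (2 * C * t 1)).and (eventually_ge_atTop 2))
  have hFpos : ∀ m, M ≤ m → 0 < F m := fun m hm =>
    lt_of_lt_of_le (by have := ht 1; positivity) (hM m hm).1
  have hle : ∀ m, M ≤ m → δ * F m ≤ m * t m := by
    intro m hm
    have h1 := h 1 m le_rfl (by have := (hM m hm).2; omega)
    have h2 := (hM m hm).1
    have h3 : F m ≤ 2 * C * (m * t m) := by
      have : F m ≤ C * ((1 : ℕ) * t 1 + m * t m) := h1
      push_cast at this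
      nlinarith
    rw [hδ, one_div, inv_mul_le_iff₀ (by positivity)]
    exact h3
  have hstep : ∀ m, M ≤ m → F M / (M : ℝ) ^ δ ≤ F m / (m : ℝ) ^ δ := by
    intro m hm
    induction m, hm using Nat.le_induction with
    | base => exact le_rfl
    | succ m hm ih =>
      refine ih.trans ?_
      have hm1 : 1 ≤ m := by have := (hM m hm).2; omega
      have hm0 : (0 : ℝ) < m := by exact_mod_cast hm1
      rw [div_le_div_iff₀ (by positivity) (by positivity)]
      have h1 : F (m + 1) = F m + t m := Finset.sum_Ico_succ_top hm1 _
      have h2 : F m * (1 + δ / m) ≤ F (m + 1) := by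
        rw [h1, mul_add, mul_one]
        gcongr
        rw [mul_div_assoc', div_le_iff₀ hm0]
        have := hle m hm
        linarith
      push_cast
      calc F m * ((m : ℝ) + 1) ^ δ ≤ F m * ((m : ℝ) ^ δ * (1 + δ / m)) := by
            have := (hFpos m hm).le
            gcongr
            exact one_add_inv_rpow_le hδ0.le hδ1 hm1
        _ = F m * (1 + δ / m) * (m : ℝ) ^ δ := by ring
        _ ≤ _ := by gcongr
  set c := F M / (M : ℝ) ^ δ with hc
  have hM0 : (0 : ℝ) < M := by exact_mod_cast (by have := (hM M le_rfl).2; omega : 0 < M)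
  have hc0 : 0 < c := div_pos (hFpos M le_rfl) (by positivity)
  have hT : Tendsto (fun n : ℕ => (n : ℝ) ^ (δ / 2)) atTop atTop :=
    (tendsto_rpow_atTop (by positivity)).comp tendsto_natCast_atTop_atTop
  obtain ⟨m, ⟨hm1, hm2⟩, hm3⟩ := (((hup (δ / 2) (by positivity)).and
    (hT.eventually_gt_atTop (1 / (δ * c)))).and (eventually_ge_atTop M)).exists
  have hm0 : (0 : ℝ) < m := lt_of_lt_of_le hM0 (by exact_mod_cast hm3)
  have h4 := hle m hm3
  have h5 := hstep m hm3
  rw [le_div_iff₀ (by positivity)] at h5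
  have h6 : (m : ℝ) ^ δ = (m : ℝ) ^ (δ / 2) * (m : ℝ) ^ (δ / 2) := by
    rw [← Real.rpow_add hm0]; congr 1; ring
  have h7 : 0 < (m : ℝ) ^ (δ / 2) := by positivity
  rw [div_lt_iff₀ (by positivity)] at hm2
  have h8 : δ * (c * (m : ℝ) ^ δ) ≤ (m : ℝ) ^ (δ / 2) := by
    calc _ ≤ δ * F m := by gcongr
      _ ≤ _ := h4.trans hm1
  rw [h6] at h8
  nlinarith

/-- If all windows failed, the series would converge and its tails `G` would satisfy `G n ≤ C * (n *
t n)`, a discrete form of `G' ≤ -δ G / n` with `δ = 1 / C`. So `G n` is `O(n ^ (-δ))`, and by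
monotonicity so is `n * t n`, against the frequent lower bound. -/
theorem exists_sum_Ico_gt {t : ℕ → ℝ} (ht : ∀ n, 0 < t n) (hanti : Antitone t)
    (hup : ∀ ε : ℝ, 0 < ε → ∀ᶠ n : ℕ in atTop, n * t n ≤ (n : ℝ) ^ ε)
    (hlow : ∀ ε : ℝ, 0 < ε → ∃ᶠ n : ℕ in atTop, (n : ℝ) ^ (-ε) ≤ n * t n) {C : ℝ} (hC : 1 ≤ C) :
    ∃ n m : ℕ, 1 ≤ n ∧ n < m ∧ C * (n * t n + m * t m) < ∑ j ∈ Finset.Ico n m, t j := by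
  by_contra! h
  have hs := not_summable_of_sum_Ico_le ht hup hC h
  have hC0 : 0 < C := by linarith
  set δ : ℝ := 1 / C with hδ
  have hδ0 : 0 < δ := by positivity
  have hδ1 : δ ≤ 1 := by rw [hδ, div_le_one hC0]; exact hC
  set G : ℕ → ℝ := fun n => ∑' j, t (j + n) with hG
  have hsn : ∀ n, Summable fun j => t (j + n) := fun n => (summable_nat_add_iff n).2 hs
  have hG0 : ∀ n, 0 < G n := fun n => (hsn n).tsum_pos (fun j => (ht _).le) 0 (ht _)
  have hGlim : Tendsto G atTop (nhds 0) := tendsto_sum_nat_add t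
  have hGsum : ∀ n m, n ≤ m → ∑ j ∈ Finset.Ico n m, t j + G m = G n := by
    intro n m hnm
    have h1 := (hsn n).sum_add_tsum_nat_add (m - n)
    rw [Finset.sum_Ico_eq_sum_range]
    simp only [hG]
    rw [← h1]
    congr 1
    · exact Finset.sum_congr rfl fun j _ => by rw [add_comm]
    · exact tsum_congr fun j => by congr 1; omega
  have hblock : ∀ k n : ℕ, k ≤ n → ((n : ℝ) - k) * t n ≤ G k := by
    intro k n hkn
    rw [← hGsum k n hkn]
    have h1 : ∑ j ∈ Finset.Ico k n, t n ≤ ∑ j ∈ Finset.Ico k n, t j :=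
      Finset.sum_le_sum fun j hj => hanti (Finset.mem_Ico.1 hj).2.le
    rw [Finset.sum_const, Nat.card_Ico, nsmul_eq_mul, Nat.cast_sub hkn] at h1
    have := (hG0 n).le
    linarith
  have hGle : ∀ n, 1 ≤ n → G n ≤ C * (n * t n) := by
    intro n hn
    -- The window is `[n, 2 * k)` with `k → ∞`: its right boundary term `2 * k * t (2 * k)` is at
    -- most `2 * G k` and disappears in the limit.
    have h1 : Tendsto (fun k => C * (n * t n + 2 * G k) + G (2 * k)) atTop
        (nhds (C * (n * t n + 2 * 0) + 0)) :=
      ((tendsto_const_nhds.add (hGlim.const_mul 2)).const_mul C).add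
        (hGlim.comp (tendsto_id.const_mul_atTop' (by norm_num)))
    have h2 : G n ≤ C * (n * t n + 2 * 0) + 0 := by
      refine ge_of_tendsto h1 ?_
      filter_upwards [eventually_gt_atTop n] with k hk
      rw [← hGsum n (2 * k) (by omega)]
      have h3 := h n (2 * k) hn (by omega)
      have h4 := hblock k (2 * k) (by omega)
      push_cast at h3 h4
      have h5 : 2 * (k : ℝ) * t (2 * k) ≤ 2 * G k := by linarith
      gcongr
      refine h3.trans ?_
      gcongr
    linarith
  have hdec : ∀ n, 1 ≤ n → G n * (n : ℝ) ^ δ ≤ G 1 := by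
    intro n hn
    induction n, hn using Nat.le_induction with
    | base => simp
    | succ n hn ih =>
      refine le_trans ?_ ih
      have hn0 : (0 : ℝ) < n := by exact_mod_cast hn
      have h1 := hGsum n (n + 1) (by omega)
      rw [Nat.Ico_succ_singleton, Finset.sum_singleton] at h1
      have h2 : δ / n * G n ≤ t n := by
        have := hGle n hn
        rw [hδ, div_div, div_mul_eq_mul_div, one_mul, div_le_iff₀ (by positivity)]
        linarith
      have h3 : G (n + 1) ≤ G n * (1 - δ / n) := by linarith
      have h4 : 0 ≤ 1 - δ / n := by
        rw [sub_nonneg, div_le_one hn0]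
        exact hδ1.trans (by exact_mod_cast hn)
      push_cast
      have hGn := (hG0 n).le
      calc G (n + 1) * ((n : ℝ) + 1) ^ δ ≤ (G n * (1 - δ / n)) * ((n : ℝ) ^ δ * (1 + δ / n)) := by
            gcongr
            exact one_add_inv_rpow_le hδ0.le hδ1 hn
        _ = G n * (n : ℝ) ^ δ * (1 - (δ / n) ^ 2) := by ring
        _ ≤ G n * (n : ℝ) ^ δ * 1 := by
            gcongr
            have := sq_nonneg (δ / n)
            linarith
        _ = _ := mul_one _
  have hT : Tendsto (fun n : ℕ => (n : ℝ) ^ (δ / 2)) atTop atTop :=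
    (tendsto_rpow_atTop (by positivity)).comp tendsto_natCast_atTop_atTop
  obtain ⟨n, hn1, hn2, hn3⟩ := ((hlow (δ / 2) (by positivity)).and_eventually
    ((hT.eventually_gt_atTop (2 * G 1 * 3 ^ δ)).and (eventually_ge_atTop 2))).exists
  have hn0 : (0 : ℝ) < n := by exact_mod_cast (by omega : 0 < n)
  -- The block `[k, n)` has length at least `n / 2`, so `n * t n ≤ 2 * G k`; the bound `n ≤ 3 * k`
  -- returns from `k` to `n` in the power estimate.
  set k := n / 2 with hk
  have hk1 : 1 ≤ k := by omega
  have hk0 : (0 : ℝ) < k := by exact_mod_cast hk1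
  have hk3 : (n : ℝ) ≤ 3 * k := by exact_mod_cast (by omega : n ≤ 3 * k)
  have hk2 : 2 * (k : ℝ) ≤ n := by exact_mod_cast (by omega : 2 * k ≤ n)
  have h1 := hblock k n (by omega)
  have h2 : n * t n ≤ 2 * G k := by
    have := ht n
    nlinarith
  have h3 := hdec k hk1
  have h4 : (n : ℝ) ^ δ ≤ 3 ^ δ * (k : ℝ) ^ δ := by
    rw [← Real.mul_rpow (by norm_num) hk0.le]
    exact Real.rpow_le_rpow hn0.le hk3 hδ0.le
  have h5 : (n : ℝ) ^ δ * (n : ℝ) ^ (-(δ / 2)) = (n : ℝ) ^ (δ / 2) := by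
    rw [← Real.rpow_add hn0]; congr 1; ring
  have h6 : (n : ℝ) ^ (δ / 2) ≤ 2 * G 1 * 3 ^ δ := by
    have hGk := (hG0 k).le
    calc (n : ℝ) ^ (δ / 2) = (n : ℝ) ^ δ * (n : ℝ) ^ (-(δ / 2)) := h5.symm
      _ ≤ (3 ^ δ * (k : ℝ) ^ δ) * (2 * G k) := by
          gcongr
          exact hn1.trans h2
      _ = 2 * (G k * (k : ℝ) ^ δ) * 3 ^ δ := by ring
      _ ≤ _ := by gcongr
  linarith

/-! ### Construction of a singular trace from windowed diagonal sums. -/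

section SingularTrace

variable {H : Type*} [NormedAddCommGroup H] [InnerProductSpace ℂ H]

/-- Keeping the basis as a finite set of vectors of `H` lets successive extensions nest, so that
their differences are orthogonal to the earlier sets. -/
theorem exists_orthonormal_finset_extension (W : Submodule ℂ H) [FiniteDimensional ℂ W]
    {s : Finset H} (hs : Orthonormal ℂ ((↑) : s → H)) (hsW : ∀ x ∈ s, x ∈ W) :
    ∃ A : Finset H, s ⊆ A ∧ Orthonormal ℂ ((↑) : A → H) ∧ A.card ≤ Module.finrank ℂ W ∧
      (∀ a ∈ A, a ∈ W) ∧
      ∀ x ∈ W, ∑ a ∈ A, ⟪a, x⟫_ℂ • a = x := by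
  classical
  have h1 : Orthonormal ℂ ((↑) : ((↑) ⁻¹' (s : Set H) : Set W) → W) := by
    rw [orthonormal_subtype_iff_ite] at hs ⊢
    intro v hv w hw
    rw [Submodule.coe_inner]
    exact (hs v hv w hw).trans (if_congr Subtype.coe_inj rfl rfl)
  obtain ⟨u, b, hu, hb⟩ := h1.exists_orthonormalBasis_extension
  refine ⟨u.map ⟨Subtype.val, Subtype.val_injective⟩, ?_, ?_, ?_, ?_, ?_⟩
  · intro x hx
    rw [Finset.mem_map]
    exact ⟨⟨x, hsW x hx⟩, hu (by simpa using hx), rfl⟩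
  · have hbo := b.orthonormal
    rw [hb] at hbo
    rw [orthonormal_subtype_iff_ite] at hbo ⊢
    intro v hv w hw
    simp only [Finset.coe_map, Function.Embedding.coeFn_mk, Set.mem_image] at hv hw
    obtain ⟨v, hv, rfl⟩ := hv
    obtain ⟨w, hw, rfl⟩ := hw
    exact (hbo v hv w hw).trans (if_congr Subtype.coe_inj.symm rfl rfl)
  · rw [Finset.card_map, Module.finrank_eq_card_basis b.toBasis, Fintype.card_coe]
  · intro a ha
    obtain ⟨w, _, rfl⟩ := Finset.mem_map.1 ha
    exact w.2
  · intro x hx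
    have h2 := congrArg Subtype.val (b.sum_repr' ⟨x, hx⟩)
    rw [hb] at h2
    rw [Finset.sum_map]
    simp only [Function.Embedding.coeFn_mk]
    rw [← Finset.sum_coe_sort]
    simpa using h2

/-- The linear map sending the formal sum `∑ c • (u, v)` to `∑ c • u * T * v`. -/
noncomputable def sandwich (T : H →L[ℂ] H) :
    ((H →L[ℂ] H) × (H →L[ℂ] H) →₀ ℂ) →ₗ[ℂ] (H →L[ℂ] H) :=
  Finsupp.linearCombination ℂ fun p => p.1 * T * p.2

theorem range_sandwich (T : H →L[ℂ] H) : LinearMap.range (sandwich T) = idealGen T := by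
  rw [sandwich, Finsupp.range_linearCombination, idealGen]
  congr 1
  ext z
  simp only [Set.mem_range, Prod.exists, Set.mem_ofPred_eq, eq_comm]

/-- The trace of `u * P * v`, where `P` is the diagonal operator with the entries `t j` at the
vectors `e j` for `j < n`. -/
noncomputable def truncTrace (e : ℕ → H) (t : ℕ → ℝ) (n : ℕ) :
    ((H →L[ℂ] H) × (H →L[ℂ] H) →₀ ℂ) →ₗ[ℂ] ℂ :=
  Finsupp.linearCombination ℂ fun p =>
    ∑ j ∈ Finset.range n, (t j : ℂ) * ⟪e j, p.2 (p.1 (e j))⟫_ℂ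

/-- A bound for the norm of `∑ c • u * S * v` when `S` is a contraction. -/
noncomputable def sandwichBound (f : (H →L[ℂ] H) × (H →L[ℂ] H) →₀ ℂ) : ℝ :=
  f.sum fun p c => ‖c‖ * (‖p.1‖ * ‖p.2‖)

theorem sandwichBound_nonneg (f : (H →L[ℂ] H) × (H →L[ℂ] H) →₀ ℂ) : 0 ≤ sandwichBound f :=
  Finset.sum_nonneg fun _ _ => by positivity

variable {T : H →L[ℂ] H} {e : ℕ → H} {t : ℕ → ℝ}

/-- Let `P` be the truncation of `T` to the first `n` vectors. Since `A` reproduces the vectors `u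
(e j)`, the truncated trace equals the sum of `⟪a, u P v a⟫` over `A`. Replacing `P` by `T` costs at
most `t n * ‖u‖ * ‖v‖` per vector, so sets `A` of size `O(n)` give an error `O(n * t n)`. -/
theorem norm_truncTrace_sub_le
    (happ : ∀ n x, ‖T x - ∑ j ∈ Finset.range n, ((t j : ℂ) * ⟪e j, x⟫_ℂ) • e j‖ ≤ t n * ‖x‖)
    (f : (H →L[ℂ] H) × (H →L[ℂ] H) →₀ ℂ) (n : ℕ) {A : Finset H}
    (hA : Orthonormal ℂ ((↑) : A → H))
    (hAf : ∀ p ∈ f.support, ∀ j < n, ∑ a ∈ A, ⟪a, p.1 (e j)⟫_ℂ • a = p.1 (e j)) :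
    ‖truncTrace e t n f - ∑ a ∈ A, ⟪a, sandwich T f a⟫_ℂ‖ ≤
      A.card * sandwichBound f * t n := by
  have hpair : ∀ p ∈ f.support,
      ‖(∑ j ∈ Finset.range n, (t j : ℂ) * ⟪e j, p.2 (p.1 (e j))⟫_ℂ) -
        ∑ a ∈ A, ⟪a, p.1 (T (p.2 a))⟫_ℂ‖ ≤ A.card * (‖p.1‖ * ‖p.2‖ * t n) := by
    intro p hp
    have h1 : (∑ j ∈ Finset.range n, (t j : ℂ) * ⟪e j, p.2 (p.1 (e j))⟫_ℂ) =
        ∑ a ∈ A, ⟪a, p.1 (∑ j ∈ Finset.range n, ((t j : ℂ) * ⟪e j, p.2 a⟫_ℂ) • e j)⟫_ℂ := by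
      simp only [map_sum, map_smul, inner_sum, inner_smul_right]
      rw [Finset.sum_comm]
      refine Finset.sum_congr rfl fun j hj => ?_
      conv_lhs => rw [← hAf p hp j (Finset.mem_range.1 hj)]
      simp only [map_sum, map_smul, inner_sum, inner_smul_right, Finset.mul_sum]
      exact Finset.sum_congr rfl fun a _ => by ring
    rw [h1, ← Finset.sum_sub_distrib, ← nsmul_eq_mul, ← Finset.sum_const]
    refine norm_sum_le_of_le _ fun a ha => ?_
    have ha1 : ‖a‖ = 1 := hA.1 ⟨a, ha⟩
    rw [← inner_sub_right, ← map_sub]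
    refine (norm_inner_le_norm _ _).trans ?_
    rw [ha1, one_mul, mul_assoc]
    refine (p.1.le_opNorm _).trans ?_
    gcongr
    rw [norm_sub_rev]
    refine (happ n _).trans ?_
    have htn : 0 ≤ t n := by
      have := (norm_nonneg _).trans (happ n a)
      rwa [ha1, mul_one] at this
    have h2 := p.2.le_opNorm a
    rw [ha1, mul_one] at h2
    rw [mul_comm]
    gcongr
  have h2 : truncTrace e t n f - ∑ a ∈ A, ⟪a, sandwich T f a⟫_ℂ =
      ∑ p ∈ f.support, f p * ((∑ j ∈ Finset.range n, (t j : ℂ) * ⟪e j, p.2 (p.1 (e j))⟫_ℂ) -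
        ∑ a ∈ A, ⟪a, p.1 (T (p.2 a))⟫_ℂ) := by
    simp only [truncTrace, sandwich, Finsupp.linearCombination_apply, Finsupp.sum, smul_eq_mul,
      mul_sub, Finset.sum_sub_distrib, sum_apply,
      smul_apply, inner_sum, inner_smul_right, mul_apply_eq_comp]
    congr 1
    rw [Finset.sum_comm]
    exact Finset.sum_congr rfl fun p _ => by rw [Finset.mul_sum]
  rw [h2]
  have h3 : (A.card : ℝ) * sandwichBound f * t n =
      ∑ p ∈ f.support, ‖f p‖ * (A.card * (‖p.1‖ * ‖p.2‖ * t n)) := by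
    simp only [sandwichBound, Finsupp.sum, Finset.mul_sum, Finset.sum_mul]
    exact Finset.sum_congr rfl fun p _ => by ring
  rw [h3]
  refine norm_sum_le_of_le _ fun p hp => ?_
  rw [norm_mul]
  gcongr
  exact hpair p hp

/-- The span of the vectors `u (e j)`, for `j < n` and `(u, v)` in the support of `f`. -/
noncomputable def leftSpan (e : ℕ → H) (f : (H →L[ℂ] H) × (H →L[ℂ] H) →₀ ℂ) (n : ℕ) :
    Submodule ℂ H :=
  Submodule.span ℂ ((fun q : ((H →L[ℂ] H) × (H →L[ℂ] H)) × ℕ => q.1.1 (e q.2)) ''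
    ↑(f.support ×ˢ Finset.range n))

instance (f : (H →L[ℂ] H) × (H →L[ℂ] H) →₀ ℂ) (n : ℕ) :
    FiniteDimensional ℂ (leftSpan e f n) :=
  FiniteDimensional.span_of_finite ℂ ((Finset.finite_toSet _).image _)

theorem leftSpan_mono (f : (H →L[ℂ] H) × (H →L[ℂ] H) →₀ ℂ) {n m : ℕ} (h : n ≤ m) :
    leftSpan e f n ≤ leftSpan e f m := by
  apply Submodule.span_mono
  apply Set.image_mono
  rw [Finset.coe_subset]
  exact Finset.product_subset_product le_rfl (Finset.range_mono h)

theorem mem_leftSpan {f : (H →L[ℂ] H) × (H →L[ℂ] H) →₀ ℂ} {n : ℕ}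
    {p : (H →L[ℂ] H) × (H →L[ℂ] H)} (hp : p ∈ f.support) {j : ℕ} (hj : j < n) :
    p.1 (e j) ∈ leftSpan e f n :=
  Submodule.subset_span ⟨(p, j), by
    rw [Finset.mem_coe, Finset.mem_product, Finset.mem_range]; exact ⟨hp, hj⟩, rfl⟩

theorem finrank_leftSpan_le (f : (H →L[ℂ] H) × (H →L[ℂ] H) →₀ ℂ) (n : ℕ) :
    Module.finrank ℂ (leftSpan e f n) ≤ f.support.card * n := by
  classical
  rw [leftSpan, ← Finset.coe_image]
  refine (finrank_span_finset_le_card _).trans (Finset.card_image_le.trans ?_)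
  rw [Finset.card_product, Finset.card_range]

/-- Any finite orthonormal set `s` can be enlarged by at most `card * n` vectors such that the trace
over the enlarged set approximates the truncated trace. -/
theorem exists_truncTrace_approx (ht : ∀ n, 0 < t n)
    (happ : ∀ n x, ‖T x - ∑ j ∈ Finset.range n, ((t j : ℂ) * ⟪e j, x⟫_ℂ) • e j‖ ≤ t n * ‖x‖)
    (f : (H →L[ℂ] H) × (H →L[ℂ] H) →₀ ℂ) {n : ℕ} (hn : 1 ≤ n) (V : Submodule ℂ H)
    [FiniteDimensional ℂ V] {s : Finset H} (hs : Orthonormal ℂ ((↑) : s → H))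
    (hsV : ∀ x ∈ s, x ∈ leftSpan e f n ⊔ V) :
    ∃ A : Finset H, s ⊆ A ∧ Orthonormal ℂ ((↑) : A → H) ∧
      (∀ a ∈ A, a ∈ leftSpan e f n ⊔ V) ∧
      ‖truncTrace e t n f - ∑ a ∈ A, ⟪a, sandwich T f a⟫_ℂ‖ ≤
        (f.support.card + Module.finrank ℂ V) * sandwichBound f * (n * t n) := by
  obtain ⟨A, h1, h2, h3, hAW, h4⟩ := exists_orthonormal_finset_extension (leftSpan e f n ⊔ V) hs hsV
  refine ⟨A, h1, h2, hAW, (norm_truncTrace_sub_le happ f n h2 fun p hp j hj =>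
    h4 _ (Submodule.mem_sup_left (mem_leftSpan hp hj))).trans ?_⟩
  have h5 : A.card ≤ (f.support.card + Module.finrank ℂ V) * n := by
    refine h3.trans ((Submodule.finrank_add_le_finrank_add_finrank _ _).trans ?_)
    rw [add_mul]
    exact add_le_add (finrank_leftSpan_le f n) (Nat.le_mul_of_pos_right _ hn)
  have h6 : (A.card : ℝ) ≤ (f.support.card + Module.finrank ℂ V) * n := by exact_mod_cast h5
  have := sandwichBound_nonneg f
  have := (ht n).le
  calc (A.card : ℝ) * sandwichBound f * t n
      ≤ ((f.support.card + Module.finrank ℂ V) * n) * sandwichBound f * t n := by gcongr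
    _ = _ := by ring

/-- The difference of two truncated traces is, up to a small error, the trace over an orthonormal
set that is orthogonal to a prescribed finite dimensional subspace. -/
theorem exists_truncTrace_sub_approx (ht : ∀ n, 0 < t n)
    (happ : ∀ n x, ‖T x - ∑ j ∈ Finset.range n, ((t j : ℂ) * ⟪e j, x⟫_ℂ) • e j‖ ≤ t n * ‖x‖)
    (f : (H →L[ℂ] H) × (H →L[ℂ] H) →₀ ℂ) (V : Submodule ℂ H) [FiniteDimensional ℂ V] :
    ∃ K : ℝ, ∀ n m : ℕ, 1 ≤ n → n ≤ m → ∃ B : Finset H, (∀ b ∈ B, b ∈ Vᗮ) ∧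
      ‖truncTrace e t m f - truncTrace e t n f - ∑ b ∈ B, ⟪b, sandwich T f b⟫_ℂ‖ ≤
        K * (n * t n + m * t m) := by
  classical
  -- Starting from a basis `s` of `V`, extend to `A` at level `n` and then to `A'` at level `m`. The
  -- sums over `A` cancel in the difference, and `A' \ A` is orthogonal to `s`, hence to `V`.
  obtain ⟨s, -, hs, -, hsV, hsV'⟩ := exists_orthonormal_finset_extension V (s := ∅)
    ⟨fun i => absurd i.2 (Finset.notMem_empty _), fun i => absurd i.2 (Finset.notMem_empty _)⟩
    (by simp)
  refine ⟨(f.support.card + Module.finrank ℂ V) * sandwichBound f, fun n m hn hnm => ?_⟩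
  obtain ⟨A, hsA, hA, hAV, hAn⟩ := exists_truncTrace_approx ht happ f hn V hs
    fun x hx => Submodule.mem_sup_right (hsV x hx)
  obtain ⟨A', hAA', hA', -, hAm⟩ := exists_truncTrace_approx ht happ f (hn.trans hnm) V hA
    fun x hx => sup_le_sup_right (leftSpan_mono f hnm) V (hAV x hx)
  refine ⟨A' \ A, fun b hb => ?_, ?_⟩
  · rw [Finset.mem_sdiff] at hb
    rw [Submodule.mem_orthogonal]
    intro x hx
    rw [← hsV' x hx, sum_inner]
    refine Finset.sum_eq_zero fun a ha => ?_
    rw [orthonormal_subtype_iff_ite] at hA'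
    rw [inner_smul_left, hA' a (hAA' (hsA ha)) b hb.1, if_neg, mul_zero]
    rintro rfl
    exact hb.2 (hsA ha)
  · rw [← Finset.sum_sdiff hAA'] at hAm
    calc _ = ‖(truncTrace e t m f - (∑ b ∈ A' \ A, ⟪b, sandwich T f b⟫_ℂ +
            ∑ b ∈ A, ⟪b, sandwich T f b⟫_ℂ)) -
          (truncTrace e t n f - ∑ b ∈ A, ⟪b, sandwich T f b⟫_ℂ)‖ := by congr 1; ring
      _ ≤ _ := (norm_sub_le _ _).trans (add_le_add hAm hAn)
      _ = _ := by ring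

/-- The functional is first defined on formal sums of pairs `(u, v)`, where linearity and cyclicity
are plain. The comparison with traces over orthonormal sets then makes it descend to operators and
gives positivity and singularity. -/
theorem exists_isSingularTrace_of_sum_Ico_gt (he : Orthonormal ℂ e) (ht : ∀ n, 0 < t n)
    (happ : ∀ n x, ‖T x - ∑ j ∈ Finset.range n, ((t j : ℂ) * ⟪e j, x⟫_ℂ) • e j‖ ≤ t n * ‖x‖)
    (hseq : ∀ C : ℝ, 1 ≤ C → ∃ n m : ℕ, 1 ≤ n ∧ n < m ∧
      C * (n * t n + m * t m) < ∑ j ∈ Finset.Ico n m, t j) :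
    ∃ τ : idealGen T →ₗ[ℂ] ℂ, IsSingularTrace T τ ∧ τ ⟨T, self_mem_idealGen T⟩ = 1 := by
  choose n m hn hnm hC using fun k : ℕ =>
    hseq (k + 1) (by have : (0 : ℝ) ≤ k := Nat.cast_nonneg k
                     linarith)
  set s : ℕ → ℝ := fun k => ∑ j ∈ Finset.Ico (n k) (m k), t j with hs
  have hs0 : ∀ k, 0 < s k := fun k =>
    Finset.sum_pos (fun j _ => ht j) (Finset.nonempty_Ico.2 (hnm k))
  have herr : ∀ K : ℝ, Tendsto (fun k => K * (n k * t (n k) + m k * t (m k)) / s k) atTop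
      (nhds 0) := by
    intro K
    have h1 : Tendsto (fun k => (n k * t (n k) + m k * t (m k)) / s k) atTop (nhds 0) := by
      refine squeeze_zero (fun k => ?_) (fun k => ?_) tendsto_one_div_add_atTop_nhds_zero_nat
      · have := (ht (n k)).le
        have := (ht (m k)).le
        have := (hs0 k).le
        positivity
      · rw [div_le_div_iff₀ (hs0 k) (by positivity), one_mul, mul_comm]
        exact (hC k).le
    simpa [mul_div_assoc] using h1.const_mul K
  -- Along an ultrafilter every bounded sequence converges, so all pairs get a limit at once; being
  -- finer than `atTop`, it still sends the boundary errors to zero.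
  set ω : Ultrafilter ℕ := hyperfilter ℕ with hω
  have hωtop : (ω : Filter ℕ) ≤ atTop := Nat.hyperfilter_le_atTop
  have hpair : ∀ (p : (H →L[ℂ] H) × (H →L[ℂ] H)), ∃ L : ℂ, Tendsto
      (fun k => (∑ j ∈ Finset.Ico (n k) (m k), (t j : ℂ) * ⟪e j, p.2 (p.1 (e j))⟫_ℂ) / (s k : ℂ))
      ω (nhds L) := by
    intro p
    obtain ⟨L, -, hL⟩ := (isCompact_closedBall (0 : ℂ) (‖p.2‖ * ‖p.1‖)).ultrafilter_le_nhds
      (ω.map fun k =>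
        (∑ j ∈ Finset.Ico (n k) (m k), (t j : ℂ) * ⟪e j, p.2 (p.1 (e j))⟫_ℂ) / (s k : ℂ)) (by
      rw [le_principal_iff, Ultrafilter.mem_coe, Ultrafilter.mem_map]
      refine univ_mem' fun k => ?_
      rw [Set.mem_preimage, mem_closedBall_zero_iff, norm_div, Complex.norm_real,
        Real.norm_of_nonneg (hs0 k).le, div_le_iff₀ (hs0 k), hs, Finset.mul_sum]
      refine norm_sum_le_of_le _ fun j _ => ?_
      rw [norm_mul, Complex.norm_real, Real.norm_of_nonneg (ht j).le, mul_comm]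
      have := (ht j).le
      gcongr
      refine (norm_inner_le_norm _ _).trans ?_
      rw [he.1, one_mul]
      refine (p.2.le_opNorm _).trans ?_
      gcongr
      refine (p.1.le_opNorm _).trans ?_
      rw [he.1, mul_one])
    exact ⟨L, hL⟩
  choose L hL using hpair
  set Λ := Finsupp.linearCombination ℂ L with hΛ
  have hlim : ∀ f, Tendsto (fun k => (truncTrace e t (m k) f - truncTrace e t (n k) f) / (s k : ℂ))
      ω (nhds (Λ f)) := by
    intro f
    have h1 : Tendsto (fun k => ∑ p ∈ f.support, f p *
        ((∑ j ∈ Finset.Ico (n k) (m k), (t j : ℂ) * ⟪e j, p.2 (p.1 (e j))⟫_ℂ) / (s k : ℂ)))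
        ω (nhds (∑ p ∈ f.support, f p * L p)) :=
      tendsto_finsetSum _ fun p _ => (hL p).const_mul _
    refine h1.congr fun k => ?_
    simp only [truncTrace, Finsupp.linearCombination_apply, Finsupp.sum, smul_eq_mul]
    rw [← Finset.sum_sub_distrib, Finset.sum_div]
    refine Finset.sum_congr rfl fun p _ => ?_
    rw [← mul_sub, Finset.sum_Ico_eq_sub _ (hnm k).le, mul_div_assoc]
  have happrox : ∀ f (V : Submodule ℂ H) [FiniteDimensional ℂ V], ∃ B : ℕ → Finset H,
      (∀ k, ∀ b ∈ B k, b ∈ Vᗮ) ∧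
      Tendsto (fun k => (∑ b ∈ B k, ⟪b, sandwich T f b⟫_ℂ) / (s k : ℂ)) ω (nhds (Λ f)) := by
    intro f V _
    obtain ⟨K, hK⟩ := exists_truncTrace_sub_approx ht happ f V
    choose B hB1 hB2 using fun k => hK (n k) (m k) (hn k) (hnm k).le
    refine ⟨B, hB1, ?_⟩
    have h1 : Tendsto (fun k => (truncTrace e t (m k) f - truncTrace e t (n k) f -
        ∑ b ∈ B k, ⟪b, sandwich T f b⟫_ℂ) / (s k : ℂ)) ω (nhds 0) := by
      refine squeeze_zero_norm (fun k => ?_) ((herr K).mono_left hωtop)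
      rw [norm_div, Complex.norm_real, Real.norm_of_nonneg (hs0 k).le]
      have := (hs0 k).le
      gcongr
      exact hB2 k
    have h2 := (hlim f).sub h1
    rw [sub_zero] at h2
    exact h2.congr fun k => by ring
  -- Well-definedness: if the formal sum represents the zero operator, every approximating trace
  -- over an orthonormal set is zero.
  have hker : LinearMap.ker (sandwich T) ≤ LinearMap.ker Λ := by
    intro f hf
    rw [LinearMap.mem_ker] at hf ⊢
    obtain ⟨B, -, hB⟩ := happrox f ⊥
    simp only [hf, zero_apply, inner_zero_right, Finset.sum_const_zero, zero_div] at hB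
    exact tendsto_nhds_unique hB tendsto_const_nhds
  set τ : idealGen T →ₗ[ℂ] ℂ := ((LinearMap.ker (sandwich T)).liftQ Λ hker) ∘ₗ
    (sandwich T).quotKerEquivRange.symm.toLinearMap ∘ₗ
    (LinearEquiv.ofEq _ _ (range_sandwich T).symm).toLinearMap with hτ
  have hτval : ∀ f (h : sandwich T f ∈ idealGen T), τ ⟨sandwich T f, h⟩ = Λ f := by
    intro f h
    have h1 : (sandwich T).quotKerEquivRange.symm ⟨sandwich T f, LinearMap.mem_range_self _ f⟩ =
        (LinearMap.ker (sandwich T)).mkQ f :=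
      (sandwich T).quotKerEquivRange_symm_apply_image f _
    simp only [hτ, LinearMap.comp_apply, LinearEquiv.coe_coe]
    exact (congrArg _ h1).trans (Submodule.liftQ_apply _ _ _)
  have hex : ∀ x ∈ idealGen T, ∃ f, sandwich T f = x := fun x hx => by
    rwa [← range_sandwich, LinearMap.mem_range] at hx
  have hτgen : ∀ u v (h : u * T * v ∈ idealGen T), τ ⟨u * T * v, h⟩ = L (u, v) := by
    intro u v h
    have h1 : sandwich T (Finsupp.single (u, v) 1) = u * T * v := by simp [sandwich]
    have h2 := hτval (Finsupp.single (u, v) 1) (h1 ▸ h)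
    simp only [h1] at h2
    rw [h2]
    simp [hΛ]
  -- The two sequences are the same, both having the entries `⟪e j, v (b (u (e j)))⟫`.
  have hLcycl : ∀ b u v : H →L[ℂ] H, L (b * u, v) = L (u, v * b) := fun b u v =>
    tendsto_nhds_unique (hL (b * u, v)) (hL (u, v * b))
  refine ⟨τ, ⟨?_, ?_, ?_⟩, ?_⟩
  · rintro ⟨x, hxI⟩ hx
    obtain ⟨f, rfl⟩ := hex x hxI
    rw [hτval]
    obtain ⟨B, -, hB⟩ := happrox f ⊥
    refine ge_of_tendsto hB (Eventually.of_forall fun k => ?_)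
    refine div_nonneg (Finset.sum_nonneg fun b _ => hx.inner_nonneg_right b) ?_
    exact_mod_cast (hs0 k).le
  · rintro b ⟨x, hx⟩
    induction hx using Submodule.span_induction with
    | mem w hw =>
      obtain ⟨u, v, rfl⟩ := hw
      have h1 := hτgen (b * u) v
      have h2 := hτgen u (v * b)
      simp only [mul_assoc] at h1 h2 ⊢
      rw [h1, h2, hLcycl]
      · exact Submodule.subset_span ⟨u, v * b, by simp only [mul_assoc]⟩
      · exact Submodule.subset_span ⟨b * u, v, by simp only [mul_assoc]⟩
    | zero => simp
    | add u v hu hv h1 h2 =>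
      have h3 := congrArg₂ (· + ·) h1 h2
      simp only [← map_add, AddMemClass.mk_add_mk] at h3
      simpa only [mul_add, add_mul] using h3
    | smul c u hu h1 =>
      have h3 := congrArg (c • ·) h1
      simp only [← map_smul, SetLike.mk_smul_mk] at h3
      simpa only [mul_smul_comm, smul_mul_assoc] using h3
  · rintro ⟨x, hxI⟩ hx
    obtain ⟨f, rfl⟩ := hex x hxI
    rw [hτval]
    -- With `B k` orthogonal to the range of the operator, every diagonal entry over `B k` is zero.
    obtain ⟨B, hB1, hB⟩ := happrox f (LinearMap.range ((sandwich T f : H →L[ℂ] H) : H →ₗ[ℂ] H))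
    refine tendsto_nhds_unique hB (tendsto_const_nhds.congr fun k => ?_)
    rw [Finset.sum_eq_zero, zero_div]
    intro b hb
    exact Submodule.inner_left_of_mem_orthogonal (LinearMap.mem_range_self _ b) (hB1 k b hb)
  · have h1 := hτgen 1 1
    simp only [one_mul, mul_one] at h1
    rw [h1 (self_mem_idealGen T)]
    refine tendsto_nhds_unique (hL (1, 1)) (tendsto_const_nhds.congr fun k => ?_)
    have h2 : (s k : ℂ) ≠ 0 := by exact_mod_cast (hs0 k).ne'
    rw [eq_comm, div_eq_one_iff_eq h2, hs]
    push_cast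
    refine Finset.sum_congr rfl fun j _ => ?_
    simp [he.1]

end SingularTrace

/-! ### Diagonal operators with respect to a Hilbert basis. -/

section Diagonal

variable {H : Type*} [NormedAddCommGroup H] [InnerProductSpace ℂ H] {ι : Type*}

theorem clm_ext_hilbertBasis (b : HilbertBasis ι ℂ H) {S T : H →L[ℂ] H}
    (h : ∀ i, S (b i) = T (b i)) : S = T :=
  ContinuousLinearMap.ext_on (Submodule.dense_iff_topologicalClosure_eq_top.2 b.dense_span)
    (by rintro _ ⟨i, rfl⟩; exact h i)

theorem exists_diagonal (b : HilbertBasis ι ℂ H) {g : ι → ℂ} {C : ℝ} (hC : 0 ≤ C)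
    (hg : ∀ i, ‖g i‖ ≤ C) : ∃ G : H →L[ℂ] H, (∀ i, G (b i) = g i • b i) ∧ ‖G‖ ≤ C := by
  have hle : ∀ (x : H) i, ‖g i * b.repr x i‖ ≤ ‖((C : ℂ) • b.repr x) i‖ := by
    intro x i
    rw [lp.coeFn_smul, Pi.smul_apply, norm_smul, norm_mul, Complex.norm_real,
      Real.norm_of_nonneg hC]
    gcongr
    exact hg i
  have hmem : ∀ x : H, Memℓp (fun i => g i * b.repr x i) 2 := fun x =>
    (lp.memℓp ((C : ℂ) • b.repr x)).mono' (hle x)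
  let L : H →ₗ[ℂ] H :=
    { toFun := fun x => b.repr.symm ⟨fun i => g i * b.repr x i, hmem x⟩
      map_add' := fun x y => by
        rw [← map_add]
        congr 1
        ext i
        change g i * b.repr (x + y) i = g i * b.repr x i + g i * b.repr y i
        rw [map_add]
        exact mul_add _ _ _
      map_smul' := fun c x => by
        rw [RingHom.id_apply, ← map_smul]
        congr 1
        ext i
        simp [mul_left_comm] }
  refine ⟨L.mkContinuous C fun x => ?_, fun i => ?_, L.mkContinuous_norm_le hC _⟩
  · change ‖b.repr.symm _‖ ≤ _
    rw [LinearIsometryEquiv.norm_map]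
    refine (lp.norm_mono (y := (C : ℂ) • b.repr x) (by norm_num) (hle x)).trans ?_
    rw [norm_smul, Complex.norm_real, Real.norm_of_nonneg hC, LinearIsometryEquiv.norm_map]
  · classical
    change b.repr.symm _ = _
    rw [LinearIsometryEquiv.symm_apply_eq, map_smul]
    ext j
    change g j * b.repr (b i) j = g i * b.repr (b i) j
    rw [b.repr_self]
    by_cases hj : j = i
    · rw [hj]
    · simp [Pi.single_eq_of_ne hj]

open Classical in
/-- The diagonal operator with the bounded family `g` of entries with respect to the Hilbert basis
`b` (with the value `0` if `g` is unbounded). -/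
noncomputable def diagonal (b : HilbertBasis ι ℂ H) (g : ι → ℂ) : H →L[ℂ] H :=
  if h : ∃ C : ℝ, 0 ≤ C ∧ ∀ i, ‖g i‖ ≤ C then
    (exists_diagonal b h.choose_spec.1 h.choose_spec.2).choose
  else 0

theorem diagonal_apply (b : HilbertBasis ι ℂ H) {g : ι → ℂ} {C : ℝ} (hC : 0 ≤ C)
    (hg : ∀ i, ‖g i‖ ≤ C) (i : ι) : diagonal b g (b i) = g i • b i := by
  have h : ∃ C : ℝ, 0 ≤ C ∧ ∀ i, ‖g i‖ ≤ C := ⟨C, hC, hg⟩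
  rw [diagonal, dif_pos h]
  exact (exists_diagonal b h.choose_spec.1 h.choose_spec.2).choose_spec.1 i

theorem norm_le_of_diagonal (b : HilbertBasis ι ℂ H) {g : ι → ℂ} {C : ℝ} (hC : 0 ≤ C)
    (hg : ∀ i, ‖g i‖ ≤ C) {G : H →L[ℂ] H} (hG : ∀ i, G (b i) = g i • b i) : ‖G‖ ≤ C := by
  obtain ⟨G', h1, h2⟩ := exists_diagonal b hC hg
  rwa [(clm_ext_hilbertBasis b fun i => by rw [hG, h1] : G = G')]

theorem norm_diagonal_le (b : HilbertBasis ι ℂ H) {g : ι → ℂ} {C : ℝ} (hC : 0 ≤ C)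
    (hg : ∀ i, ‖g i‖ ≤ C) : ‖diagonal b g‖ ≤ C :=
  norm_le_of_diagonal b hC hg fun i => diagonal_apply b hC hg i

/-- The difference is diagonal with the first `n` chosen entries replaced by zero, so its norm is
controlled by the largest entry left. -/
theorem norm_sub_sum_le (b : HilbertBasis ι ℂ H) {T : H →L[ℂ] H} {g : ι → ℝ}
    (hT : ∀ i, T (b i) = (g i : ℂ) • b i) (hg : ∀ i, 0 ≤ g i) {c : ℕ → ι}
    (hc : Function.Injective c) {n : ℕ} (hn : ∀ i, (∀ j < n, c j ≠ i) → g i ≤ g (c n)) (x : H) :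
    ‖T x - ∑ j ∈ Finset.range n, ((g (c j) : ℂ) * ⟪b (c j), x⟫_ℂ) • b (c j)‖ ≤
      g (c n) * ‖x‖ := by
  classical
  set P : H →L[ℂ] H := T - ∑ j ∈ Finset.range n,
    (g (c j) : ℂ) • (innerSL ℂ (b (c j))).smulRight (b (c j)) with hP
  have hPx : P x = T x - ∑ j ∈ Finset.range n, ((g (c j) : ℂ) * ⟪b (c j), x⟫_ℂ) • b (c j) := by
    simp only [hP, sub_apply, sum_apply, smul_apply, ContinuousLinearMap.smulRight_apply,
      innerSL_apply_apply, smul_smul]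
  rw [← hPx]
  refine P.le_of_opNorm_le ?_ x
  refine norm_le_of_diagonal b (g := fun i => if ∃ j < n, c j = i then 0 else (g i : ℂ)) (hg _)
    (fun i => ?_) (fun i => ?_)
  · split_ifs with h
    · simpa using hg _
    · rw [Complex.norm_real, Real.norm_of_nonneg (hg i)]
      push Not at h
      exact hn i h
  · have hPi : P (b i) = (g i : ℂ) • b i -
        ∑ j ∈ Finset.range n, ((g (c j) : ℂ) * ⟪b (c j), b i⟫_ℂ) • b (c j) := by
      simp only [hP, sub_apply, sum_apply, smul_apply, ContinuousLinearMap.smulRight_apply,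
        innerSL_apply_apply, smul_smul, hT]
    rw [hPi]
    simp only [orthonormal_iff_ite.1 b.orthonormal]
    split_ifs with h
    · obtain ⟨j, hj, rfl⟩ := h
      rw [Finset.sum_eq_single_of_mem j (Finset.mem_range.2 hj)]
      · simp
      · intro k _ hk
        rw [if_neg (fun h => hk (hc h))]
        simp
    · push Not at h
      rw [Finset.sum_eq_zero, sub_zero]
      intro j hj
      rw [if_neg (h j (Finset.mem_range.1 hj))]
      simp

end Diagonal

/-! ### Functional calculus on eigenvectors. -/

section Spectral

variable {H : Type*} [NormedAddCommGroup H] [InnerProductSpace ℂ H] [CompleteSpace H]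

/-- The functions on the spectrum for which the formula holds form a closed subalgebra containing
the constants and the identity, so Stone–Weierstrass gives all of them. -/
theorem cfc_apply_eigenvector {a : H →L[ℂ] H} (ha : IsSelfAdjoint a) {f : ℝ → ℝ}
    (hf : Continuous f) {v : H} (hv : v ≠ 0) {x : ℝ} (h : a v = (x : ℂ) • v) :
    cfc f a v = (f x : ℂ) • v := by
  have hx : x ∈ spectrum ℝ a := by
    rw [spectrum.mem_iff]
    rintro ⟨u, hu⟩
    apply hv
    have h1 : (u : H →L[ℂ] H) v = 0 := by
      rw [hu, sub_apply, h, Algebra.algebraMap_eq_smul_one]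
      simp
    have h2 : (↑u⁻¹ : H →L[ℂ] H) ((u : H →L[ℂ] H) v) = v :=
      congrArg (fun S : H →L[ℂ] H => S v) u.inv_mul
    rw [h1, map_zero] at h2
    exact h2.symm
  rw [cfc_apply f a ha hf.continuousOn]
  suffices hP : ∀ g : C(spectrum ℝ a, ℝ), cfcHom ha g v = (g ⟨x, hx⟩ : ℂ) • v from hP _
  intro g
  induction g using ContinuousMap.induction_on_of_compact with
  | const r =>
    have h1 : ContinuousMap.const (spectrum ℝ a) r = algebraMap ℝ C(spectrum ℝ a, ℝ) r := rfl
    rw [h1, AlgHomClass.commutes, Algebra.algebraMap_eq_smul_one]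
    simp [← h1]
  | id => rw [cfcHom_id ha]; exact h
  | star_id =>
    have h1 : star ((ContinuousMap.id ℝ).restrict (spectrum ℝ a)) =
        (ContinuousMap.id ℝ).restrict (spectrum ℝ a) := rfl
    rw [h1, cfcHom_id ha]
    exact h
  | add f g hf hg =>
    rw [map_add, add_apply, hf, hg, ContinuousMap.add_apply, Complex.ofReal_add, add_smul]
  | mul f g hf hg =>
    rw [map_mul, mul_apply_eq_comp, hg, map_smul, hf, smul_smul, ContinuousMap.mul_apply,
      Complex.ofReal_mul, mul_comm]
  | frequently f hf =>
    have hcl : IsClosed {g : C(spectrum ℝ a, ℝ) | cfcHom ha g v = (g ⟨x, hx⟩ : ℂ) • v} := by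
      refine isClosed_eq ?_ ?_
      · exact (cfcHom_continuous ha).clm_apply continuous_const
      · exact (Complex.continuous_ofReal.comp (continuous_eval_const _)).smul
          continuous_const
    exact hcl.closure_subset (mem_closure_iff_frequently.2 hf)

theorem abs_apply_eigenvector {a : H →L[ℂ] H} (ha : IsSelfAdjoint a) {v : H} (hv : v ≠ 0) {x : ℝ}
    (h : a v = (x : ℂ) • v) : CFC.abs a v = ((|x| : ℝ) : ℂ) • v := by
  rw [CFC.abs_eq_cfc_norm a ha]
  exact cfc_apply_eigenvector ha continuous_norm hv h

theorem abs_rpow_apply_eigenvector {a : H →L[ℂ] H} (ha : IsSelfAdjoint a) {d : ℝ} (hd : 0 < d)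
    {v : H} (hv : v ≠ 0) {x : ℝ} (h : a v = (x : ℂ) • v) :
    (CFC.abs a ^ d : H →L[ℂ] H) v = ((|x| ^ d : ℝ) : ℂ) • v := by
  rw [CFC.rpow_eq_cfc_real (CFC.abs_nonneg a)]
  exact cfc_apply_eigenvector (CFC.abs_nonneg a).isSelfAdjoint
    (Real.continuous_rpow_const hd.le) hv (abs_apply_eigenvector ha hv h)

end Spectral

/-! ### Diagonalisation of the compact inverse and ordering of its eigenvalues. -/

section Eigenbasis

universe u
variable {H : Type u} [NormedAddCommGroup H] [InnerProductSpace ℂ H] [CompleteSpace H]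

theorem exists_eigenbasis {R : H →L[ℂ] H} (hc : IsCompactOperator R)
    (hs : (R : H →ₗ[ℂ] H).IsSymmetric) (hinj : Function.Injective R) :
    ∃ (ι : Type u) (b : HilbertBasis ι ℂ H) (r : ι → ℝ), (∀ i, R (b i) = (r i : ℂ) • b i) ∧
      (∀ i, r i ≠ 0) ∧ ∀ s : ℝ, 0 < s → {i | s < |r i|}.Finite := by
  have hcl : ∀ μ : ℂ, IsClosed (Module.End.eigenspace (R : H →ₗ[ℂ] H) μ : Set H) := by
    intro μ
    have : (Module.End.eigenspace (R : H →ₗ[ℂ] H) μ : Set H) = {x | R x = μ • x} := by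
      ext x
      simp
    rw [this]
    exact isClosed_eq R.continuous (continuous_const_smul μ)
  have hcompl : ∀ μ : ℂ, CompleteSpace (Module.End.eigenspace (R : H →ₗ[ℂ] H) μ) := fun μ =>
    (hcl μ).completeSpace_coe
  choose w β hβ using fun μ : ℂ => exists_hilbertBasis ℂ (Module.End.eigenspace (R : H →ₗ[ℂ] H) μ)
  have horth := (hs.orthogonalFamily_eigenspaces).orthonormal_sigma_orthonormal
    (v_family := fun μ (i : w μ) => β μ i) fun μ => (β μ).orthonormal
  have hbot : (Submodule.span ℂ (Set.range fun a : Σ μ : ℂ, w μ => (β a.1 a.2 : H)))ᗮ = ⊥ := by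
    rw [eq_bot_iff, ← ContinuousLinearMap.orthogonalComplement_iSup_eigenspaces_eq_bot hc hs]
    intro x hx
    rw [Submodule.mem_orthogonal] at hx ⊢
    suffices h : ⨆ μ, Module.End.eigenspace (R : H →ₗ[ℂ] H) μ ≤ (ℂ ∙ x)ᗮ from fun u hu =>
      Submodule.mem_orthogonal_singleton_iff_inner_left.1 (h hu)
    refine iSup_le fun μ v hv => ?_
    rw [Submodule.mem_orthogonal_singleton_iff_inner_left]
    have h1 := (β μ).hasSum_repr ⟨v, hv⟩
    have h2 := (h1.mapL (Submodule.subtypeL _)).mapL (innerSL ℂ x)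
    have h3 : ⟪x, v⟫_ℂ = 0 := by
      refine h2.unique ?_
      convert hasSum_zero with i
      have h4 := hx _ (Submodule.subset_span ⟨⟨μ, i⟩, rfl⟩)
      simp only at h4
      simp [inner_eq_zero_symm.1 h4]
    exact inner_eq_zero_symm.1 h3
  let b : HilbertBasis (Σ μ : ℂ, w μ) ℂ H := HilbertBasis.mkOfOrthogonalEqBot horth hbot
  have hb : ∀ a, b a = (β a.1 a.2 : H) := fun a =>
    congrFun (HilbertBasis.coe_mkOfOrthogonalEqBot horth hbot) a
  have hRb : ∀ a, R (b a) = a.1 • b a := fun a => by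
    rw [hb]
    exact Module.End.mem_eigenspace_iff.1 (β a.1 a.2).2
  have hne : ∀ a, b a ≠ 0 := fun a => b.orthonormal.ne_zero a
  have hreal : ∀ a : Σ μ : ℂ, w μ, ((a.1.re : ℝ) : ℂ) = a.1 := fun a =>
    Complex.conj_eq_iff_re.1 (hs.conj_eigenvalue_eq_self
      (Module.End.hasEigenvalue_of_hasEigenvector
        ⟨Module.End.mem_eigenspace_iff.2 (hRb a), hne a⟩))
  refine ⟨Σ μ : ℂ, w μ, b, fun a => a.1.re, fun a =>
    (hRb a).trans (congrArg (· • b a) (hreal a).symm), fun a h => ?_,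
    fun s hs0 => ?_⟩
  · change a.1.re = 0 at h
    have h1 := hRb a
    rw [← hreal a, h, Complex.ofReal_zero, zero_smul] at h1
    exact hne a (hinj (h1.trans (map_zero R).symm))
  · by_contra hinf
    have hinf' : Set.Infinite {i : Σ μ : ℂ, w μ | s < |i.1.re|} := hinf
    set c := hinf'.natEmbedding with hcdef
    obtain ⟨K, hK, hKs⟩ := hc.image_closedBall_subset_compact 1
    have hmem : ∀ n, R (b (c n)) ∈ K := fun n => hKs ⟨b (c n), by
      rw [mem_closedBall_zero_iff, b.orthonormal.1], rfl⟩
    obtain ⟨y, -, φ, hφ, hlim⟩ := hK.tendsto_subseq hmem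
    have hcau := hlim.cauchySeq
    rw [Metric.cauchySeq_iff'] at hcau
    obtain ⟨N, hN⟩ := hcau s hs0
    have h1 := hN (N + 1) (by omega)
    have hij : (c (φ (N + 1)) : Σ μ : ℂ, w μ) ≠ c (φ N) := fun h => by
      have := hφ.injective (c.injective (Subtype.val_injective h))
      omega
    simp only [Function.comp_apply, hRb, dist_eq_norm] at h1
    -- Pairing with the first eigenvector shows that images of distinct eigenvectors with `s < |r
    -- i|` stay more than `s` apart, which no Cauchy subsequence allows.
    have h2 : ⟪b (c (φ (N + 1))), (c (φ (N + 1))).1.1 • b (c (φ (N + 1))) -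
        (c (φ N)).1.1 • b (c (φ N))⟫_ℂ = (c (φ (N + 1))).1.1 := by
      rw [inner_sub_right, inner_smul_right, inner_smul_right, b.orthonormal.2 hij,
        inner_self_eq_norm_sq_to_K, b.orthonormal.1]
      simp
    have h3 := norm_inner_le_norm (𝕜 := ℂ) (b (c (φ (N + 1))))
      ((c (φ (N + 1))).1.1 • b (c (φ (N + 1))) - (c (φ N)).1.1 • b (c (φ N)))
    rw [h2, b.orthonormal.1, one_mul] at h3
    have h4 : s < |(c (φ (N + 1))).1.1.re| := (c (φ (N + 1))).2
    have h5 := Complex.abs_re_le_norm (c (φ (N + 1))).1.1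
    linarith

end Eigenbasis

/-- Only finitely many values lie above a positive level, so `ρ` attains a maximum off every finite
set and a greedy choice works. Surjectivity of `c` is not needed: the maximality property alone
bounds the remaining entries. -/
theorem exists_decreasing_enumeration {ι : Type*} [Infinite ι] {ρ : ι → ℝ} (h0 : ∀ i, 0 < ρ i)
    (hfin : ∀ s : ℝ, 0 < s → {i | s < ρ i}.Finite) :
    ∃ c : ℕ → ι, Function.Injective c ∧ ∀ n i, (∀ j < n, c j ≠ i) → ρ i ≤ ρ (c n) := by
  classical
  have hmax : ∀ F : Finset ι, ∃ i ∉ F, ∀ j ∉ F, ρ j ≤ ρ i := by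
    intro F
    obtain ⟨i₀, hi₀⟩ := Infinite.exists_notMem_finset F
    have hf : Set.Finite {i | i ∉ F ∧ ρ i₀ ≤ ρ i} :=
      (hfin (ρ i₀ / 2) (half_pos (h0 i₀))).subset fun i hi =>
        lt_of_lt_of_le (half_lt_self (h0 i₀)) hi.2
    obtain ⟨i, hi, hmax⟩ := hf.exists_maximalFor ρ _ ⟨i₀, hi₀, le_rfl⟩
    refine ⟨i, hi.1, fun j hj => ?_⟩
    rcases le_total (ρ i₀) (ρ j) with h | h
    · by_contra hlt
      exact hlt (hmax ⟨hj, h⟩ (not_le.1 hlt).le)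
    · exact h.trans hi.2
  choose nx hnx1 hnx2 using hmax
  let S : ℕ → Finset ι := fun n => Nat.rec ∅ (fun _ s => insert (nx s) s) n
  have hS : ∀ n, S (n + 1) = insert (nx (S n)) (S n) := fun n => rfl
  have hmem : ∀ n i, i ∈ S n ↔ ∃ j < n, nx (S j) = i := by
    intro n i
    induction n with
    | zero => simp [S]
    | succ n ih =>
      rw [hS, Finset.mem_insert, ih]
      constructor
      · rintro (rfl | ⟨j, hj, h⟩)
        · exact ⟨n, by omega, rfl⟩
        · exact ⟨j, by omega, h⟩
      · rintro ⟨j, hj, h⟩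
        rcases Nat.lt_succ_iff_lt_or_eq.1 hj with h' | rfl
        · exact Or.inr ⟨j, h', h⟩
        · exact Or.inl h.symm
  refine ⟨fun n => nx (S n), ?_, fun n i hi => hnx2 _ _ ?_⟩
  · have hlt : ∀ j n, j < n → nx (S j) ≠ nx (S n) := fun j n h heq =>
      hnx1 (S n) ((hmem n _).2 ⟨j, h, heq⟩)
    intro j n h
    rcases lt_trichotomy j n with h' | h' | h'
    · exact absurd h (hlt j n h')
    · exact h'
    · exact absurd h.symm (hlt n j h')
  · rw [hmem]
    rintro ⟨j, hj, h⟩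
    exact hi j hj h

/-! ### Identification of the singular values `mu` with the ordered eigenvalues. -/

section Mu

variable {H : Type*} [NormedAddCommGroup H] [InnerProductSpace ℂ H] [CompleteSpace H] {ι : Type*}

theorem mem_span_of_mem_eigenspace (b : HilbertBasis ι ℂ H) {P : H →L[ℂ] H} (hP : IsSelfAdjoint P)
    {ρ : ι → ℝ} (hb : ∀ i, P (b i) = (ρ i : ℂ) • b i) {s : ℝ} {F : Finset ι}
    (hF : ∀ i, s < ρ i → i ∈ F) {t : ℝ} (ht : s < t) {v : H} (hv : P v = (t : ℂ) • v) :
    v ∈ Submodule.span ℂ (b '' F) := by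
  have h1 : ∀ i ∉ F, b.repr v i • b i = 0 := by
    intro i hi
    have h2 : ⟪b i, P v⟫_ℂ = ⟪P (b i), v⟫_ℂ := (hP.isSymmetric (b i) v).symm
    rw [hb, hv, inner_smul_left, inner_smul_right, Complex.conj_ofReal] at h2
    have h3 : (ρ i : ℂ) ≠ t := by
      intro h
      rw [Complex.ofReal_inj] at h
      exact hi (hF i (h ▸ ht))
    have h4 : ⟪b i, v⟫_ℂ = 0 := by
      by_contra hne
      exact h3 (mul_right_cancel₀ hne h2).symm
    rw [b.repr_apply_apply, h4, zero_smul]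
  have h2 := (b.hasSum_repr v).unique (hasSum_sum_of_ne_finset_zero h1)
  rw [h2]
  exact Submodule.sum_mem _ fun i hi =>
    Submodule.smul_mem _ _ (Submodule.subset_span ⟨i, hi, rfl⟩)

/-- If `|r (c n)| > s`, then `b (c 0), …, b (c n)` are `n + 1` independent vectors in the
eigenspaces above `s`; otherwise these eigenspaces lie in the span of the first `n` vectors. -/
theorem distribution_le_iff (b : HilbertBasis ι ℂ H) {R : H →L[ℂ] H} (hR : IsSelfAdjoint R)
    {r : ι → ℝ} (hb : ∀ i, R (b i) = (r i : ℂ) • b i) {c : ℕ → ι} (hc : Function.Injective c)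
    (hmax : ∀ n i, (∀ j < n, c j ≠ i) → |r i| ≤ |r (c n)|) (s : ℝ) (n : ℕ) :
    distribution R s ≤ n ↔ |r (c n)| ≤ s := by
  classical
  have hab : ∀ i, CFC.abs R (b i) = ((|r i| : ℝ) : ℂ) • b i := fun i =>
    abs_apply_eigenvector hR (b.orthonormal.ne_zero i) (hb i)
  have hanti : ∀ j n, j ≤ n → |r (c n)| ≤ |r (c j)| := fun j n h =>
    hmax j (c n) fun k hk heq => by have := hc heq; omega
  rw [distribution, Cardinal.toENat_le_natCast]
  constructor
  · intro h
    by_contra! hlt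
    set W := ⨆ t : Set.Ioi s,
      Module.End.eigenspace ((CFC.abs R : H →L[ℂ] H) : H →ₗ[ℂ] H) ((t : ℝ) : ℂ) with hW
    have hmem : ∀ j : Fin (n + 1), b (c j) ∈ W := fun j =>
      Submodule.mem_iSup_of_mem (p := fun t : Set.Ioi s =>
        Module.End.eigenspace ((CFC.abs R : H →L[ℂ] H) : H →ₗ[ℂ] H) ((t : ℝ) : ℂ))
        ⟨|r (c j)|, lt_of_lt_of_le hlt (hanti j n (by omega))⟩
        (Module.End.mem_eigenspace_iff.2 (hab (c j)))
    have hli : LinearIndependent ℂ fun j : Fin (n + 1) => (⟨b (c j), hmem j⟩ : W) := by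
      refine LinearIndependent.of_comp W.subtype ?_
      exact b.orthonormal.linearIndependent.comp (fun j : Fin (n + 1) => c j)
        (hc.comp Fin.val_injective)
    have h1 := hli.cardinal_lift_le_rank.trans (Cardinal.lift_le.2 h)
    rw [Cardinal.lift_natCast, Cardinal.mk_fin, Cardinal.lift_natCast, Nat.cast_le] at h1
    omega
  · intro h
    have h1 : (⨆ t : Set.Ioi s,
        Module.End.eigenspace ((CFC.abs R : H →L[ℂ] H) : H →ₗ[ℂ] H) ((t : ℝ) : ℂ)) ≤
        Submodule.span ℂ (((Finset.range n).image fun j => b (c j) : Finset H) : Set H) := by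
      refine iSup_le fun t v hv => ?_
      have h2 := mem_span_of_mem_eigenspace b (CFC.abs_nonneg R).isSelfAdjoint hab (s := s)
        (F := (Finset.range n).image c) (fun i hi => ?_) t.2 (Module.End.mem_eigenspace_iff.1 hv)
      · simpa [Set.image_image] using h2
      · by_contra hni
        simp only [Finset.mem_image, Finset.mem_range, not_exists, not_and] at hni
        exact absurd (hmax n i hni) (by linarith)
    refine (Submodule.rank_mono h1).trans ((rank_span_finset_le _).trans ?_)
    exact_mod_cast Finset.card_image_le.trans (Finset.card_range n).le

theorem mu_eq (b : HilbertBasis ι ℂ H) {R : H →L[ℂ] H} (hR : IsSelfAdjoint R)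
    {r : ι → ℝ} (hb : ∀ i, R (b i) = (r i : ℂ) • b i) {c : ℕ → ι} (hc : Function.Injective c)
    (hmax : ∀ n i, (∀ j < n, c j ≠ i) → |r i| ≤ |r (c n)|) (n : ℕ) : mu R n = |r (c n)| := by
  simp only [mu, distribution_le_iff b hR hb hc hmax]
  have : {s : ℝ | 0 ≤ s ∧ |r (c n)| ≤ s} = Set.Ici |r (c n)| := by
    ext s
    exact ⟨fun h => h.2, fun h => ⟨(abs_nonneg _).trans h, h⟩⟩
  rw [this, csInf_Ici]

/-- From the dimension on, `mu` vanishes and the logarithmic quotients are infinite. This is how a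
non-zero box dimension forces infinitely many eigenvalues. -/
theorem boxDimension_eq_zero_of_finiteDimensional [FiniteDimensional ℂ H] (D : H →ₗ.[ℂ] H) :
    boxDimension D = 0 := by
  have hmu : ∀ n, Module.finrank ℂ H ≤ n → mu (inverseOp D) n = 0 := by
    intro n hn
    have h1 : ∀ s, distribution (inverseOp D) s ≤ n := by
      intro s
      rw [distribution, Cardinal.toENat_le_natCast, ← Module.finrank_eq_rank]
      exact_mod_cast (Submodule.finrank_le _).trans hn
    have h2 : {s : ℝ | 0 ≤ s ∧ distribution (inverseOp D) s ≤ n} = Set.Ici 0 := by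
      ext s
      exact ⟨fun h => h.1, fun h => ⟨h, h1 s⟩⟩
    rw [mu, h2, csInf_Ici]
  have hlim : Tendsto (fun n : ℕ => ENNReal.log (eigenvalueSeq D n) / ENNReal.log (n : ℝ≥0∞))
      atTop (nhds ⊤) := by
    refine tendsto_const_nhds.congr' ?_
    filter_upwards [eventually_ge_atTop (Module.finrank ℂ H), eventually_ge_atTop 2] with n hn hn2
    rw [eigenvalueSeq, hmu n hn, ENNReal.ofReal_zero, ENNReal.inv_zero, ENNReal.log_top,
      EReal.top_div_of_pos_ne_top]
    · rw [ENNReal.zero_lt_log_iff]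
      exact_mod_cast hn2
    · rw [Ne, ENNReal.log_eq_top_iff]
      exact ENNReal.natCast_ne_top n
  rw [boxDimension, hlim.liminf_eq, EReal.toENNReal_top, ENNReal.inv_top]

end Mu

/-! ### Power bounds encoded by the box dimension. -/

section Asymptotics

variable {H : Type*} [NormedAddCommGroup H] [InnerProductSpace ℂ H] [CompleteSpace H]

/-- Write `u n` for the logarithmic quotient, whose lower limit is `1 / d`. Then `log (n * mu ^ d) =
(1 - d * u n) * log n`, and `u n` is eventually above `(1 - ε) / d` but only frequently below `(1 +
ε) / d`. -/
theorem asymptotics_of_boxDimension {D : H →ₗ.[ℂ] H} (hmu : ∀ n, 0 < mu (inverseOp D) n)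
    (h0 : boxDimension D ≠ 0) (htop : boxDimension D ≠ ⊤) :
    (∀ ε : ℝ, 0 < ε → ∀ᶠ n : ℕ in atTop,
      n * mu (inverseOp D) n ^ (boxDimension D).toReal ≤ (n : ℝ) ^ ε) ∧
    ∀ ε : ℝ, 0 < ε → ∃ᶠ n : ℕ in atTop,
      (n : ℝ) ^ (-ε) ≤ n * mu (inverseOp D) n ^ (boxDimension D).toReal := by
  set d := (boxDimension D).toReal with hd
  have hd0 : 0 < d := ENNReal.toReal_pos h0 htop
  set u : ℕ → EReal := fun n => ENNReal.log (eigenvalueSeq D n) / ENNReal.log (n : ℝ≥0∞) with hu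
  have hbox : boxDimension D = (liminf u atTop).toENNReal⁻¹ := rfl
  have hne0 : (liminf u atTop).toENNReal ≠ 0 := fun h => htop (by rw [hbox, h, ENNReal.inv_zero])
  have hnetop : (liminf u atTop).toENNReal ≠ ⊤ := fun h => h0 (by rw [hbox, h, ENNReal.inv_top])
  have hL : liminf u atTop = ((d⁻¹ : ℝ) : EReal) := by
    have hpos : 0 < liminf u atTop := by
      by_contra h
      exact hne0 (EReal.toENNReal_of_nonpos (not_lt.1 h))
    rw [hd, hbox, ENNReal.toReal_inv, inv_inv, EReal.coe_ennreal_toReal hnetop,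
      EReal.coe_toENNReal hpos.le]
  have huval : ∀ n : ℕ, 2 ≤ n →
      u n = ((-Real.log (mu (inverseOp D) n) / Real.log n : ℝ) : EReal) := by
    intro n hn
    have hn0 : (0 : ℝ) < n := by exact_mod_cast (by omega : 0 < n)
    rw [hu]
    simp only
    rw [eigenvalueSeq, ← ENNReal.ofReal_inv_of_pos (hmu n),
      ENNReal.log_ofReal_of_pos (inv_pos.2 (hmu n)), Real.log_inv, ← ENNReal.ofReal_natCast,
      ENNReal.log_ofReal_of_pos hn0, EReal.coe_div]
  have hkey : ∀ n : ℕ, 2 ≤ n → Real.log (n * mu (inverseOp D) n ^ d) =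
      Real.log n + d * Real.log (mu (inverseOp D) n) := by
    intro n hn
    have hn0 : (n : ℝ) ≠ 0 := by exact_mod_cast (by omega : n ≠ 0)
    rw [Real.log_mul hn0 (Real.rpow_pos_of_pos (hmu n) d).ne', Real.log_rpow (hmu n)]
  constructor
  · intro ε hε
    have h1 : ((d⁻¹ * (1 - ε) : ℝ) : EReal) < liminf u atTop := by
      rw [hL, EReal.coe_lt_coe_iff]
      have := inv_pos.2 hd0
      nlinarith
    filter_upwards [eventually_lt_of_lt_liminf h1, eventually_ge_atTop 2] with n hn hn2
    rw [huval n hn2, EReal.coe_lt_coe_iff] at hn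
    have hn1 : (1 : ℝ) < n := by exact_mod_cast (by omega : 1 < n)
    have hlog := Real.log_pos hn1
    have hmun := Real.rpow_pos_of_pos (hmu n) d
    rw [← Real.log_le_log_iff (by positivity) (by positivity), hkey n hn2,
      Real.log_rpow (by positivity)]
    rw [lt_div_iff₀ hlog, mul_assoc, inv_mul_lt_iff₀ hd0] at hn
    linarith
  · intro ε hε
    have h1 : liminf u atTop < ((d⁻¹ * (1 + ε) : ℝ) : EReal) := by
      rw [hL, EReal.coe_lt_coe_iff]
      have := inv_pos.2 hd0
      nlinarith
    refine ((frequently_lt_of_liminf_lt (by isBoundedDefault) h1).and_eventually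
      (eventually_ge_atTop 2)).mono ?_
    rintro n ⟨hn, hn2⟩
    rw [huval n hn2, EReal.coe_lt_coe_iff] at hn
    have hn1 : (1 : ℝ) < n := by exact_mod_cast (by omega : 1 < n)
    have hlog := Real.log_pos hn1
    have hmun := Real.rpow_pos_of_pos (hmu n) d
    rw [← Real.log_le_log_iff (by positivity) (by positivity), hkey n hn2,
      Real.log_rpow (by positivity)]
    rw [div_lt_iff₀ hlog, mul_assoc, lt_inv_mul_iff₀ hd0] at hn
    linarith

end Asymptotics

/-! ### Off-diagonal decay for operators with bounded commutator. -/

section Band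

variable {H : Type*} [NormedAddCommGroup H] [InnerProductSpace ℂ H] {ι : Type*}

theorem clm_ext_inner (b : HilbertBasis ι ℂ H) {S T : H →L[ℂ] H}
    (h : ∀ i j, ⟪b i, S (b j)⟫_ℂ = ⟪b i, T (b j)⟫_ℂ) : S = T :=
  clm_ext_hilbertBasis b fun j => b.repr.injective <| lp.ext <| funext fun i => by
    rw [b.repr_apply_apply, b.repr_apply_apply, h]

theorem inner_apply_of_diagonal (b : HilbertBasis ι ℂ H) {g : ι → ℂ} {G : H →L[ℂ] H}
    (hG : ∀ i, G (b i) = g i • b i) (i : ι) (v : H) : ⟪b i, G v⟫_ℂ = g i * ⟪b i, v⟫_ℂ := by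
  classical
  have h : (innerSL ℂ (b i)).comp G = g i • innerSL ℂ (b i) := by
    refine ContinuousLinearMap.ext_on
      (Submodule.dense_iff_topologicalClosure_eq_top.2 b.dense_span) ?_
    rintro _ ⟨j, rfl⟩
    simp only [ContinuousLinearMap.comp_apply, innerSL_apply_apply, hG, inner_smul_right,
      smul_apply, orthonormal_iff_ite.1 b.orthonormal, smul_eq_mul]
    split_ifs with hij
    · rw [hij]
    · simp
  exact congrArg (fun f : H →L[ℂ] ℂ => f v) h

open Classical in
/-- The orthogonal projection onto the closed span of the vectors `b i` with `i ∈ S`. -/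
noncomputable def diagProj (b : HilbertBasis ι ℂ H) (S : Set ι) : H →L[ℂ] H :=
  diagonal b fun i => if i ∈ S then 1 else 0

open Classical in
theorem diagProj_apply (b : HilbertBasis ι ℂ H) (S : Set ι) (i : ι) :
    diagProj b S (b i) = (if i ∈ S then 1 else 0 : ℂ) • b i :=
  diagonal_apply b zero_le_one (fun i => by split_ifs <;> simp) i

theorem norm_diagProj_le (b : HilbertBasis ι ℂ H) (S : Set ι) : ‖diagProj b S‖ ≤ 1 :=
  norm_diagonal_le b zero_le_one fun i => by split_ifs <;> simp

theorem inner_diagProj_mul_mul (b : HilbertBasis ι ℂ H) (S S' : Set ι) (x : H →L[ℂ] H) (i j : ι)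
    {p : Prop} [Decidable p] (hp : i ∈ S ∧ j ∈ S' ↔ p) :
    ⟪b i, (diagProj b S * x * diagProj b S') (b j)⟫_ℂ = if p then ⟪b i, x (b j)⟫_ℂ else 0 := by
  rw [mul_apply_eq_comp, mul_apply_eq_comp, inner_apply_of_diagonal b (diagProj_apply b S),
    diagProj_apply, map_smul, inner_smul_right]
  by_cases h1 : i ∈ S <;> by_cases h2 : j ∈ S' <;> simp [h1, h2, ← hp]

theorem finiteDimensional_range_diagProj (b : HilbertBasis ι ℂ H) {S : Set ι} (hS : S.Finite) :
    FiniteDimensional ℂ (LinearMap.range (diagProj b S : H →ₗ[ℂ] H)) := by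
  classical
  have h : diagProj b S = ∑ i ∈ hS.toFinset, (innerSL ℂ (b i)).smulRight (b i) := by
    refine clm_ext_hilbertBasis b fun j => ?_
    simp only [diagProj_apply, sum_apply, ContinuousLinearMap.smulRight_apply,
      innerSL_apply_apply, orthonormal_iff_ite.1 b.orthonormal]
    simp
  have hle : LinearMap.range (diagProj b S : H →ₗ[ℂ] H) ≤ Submodule.span ℂ (b '' S) := by
    rintro _ ⟨v, rfl⟩
    rw [h]
    simp only [ContinuousLinearMap.coe_coe, sum_apply, ContinuousLinearMap.smulRight_apply]
    exact Submodule.sum_mem _ fun i hi =>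
      Submodule.smul_mem _ _ (Submodule.subset_span ⟨i, hS.mem_toFinset.1 hi, rfl⟩)
  have := FiniteDimensional.span_of_finite ℂ (hS.image b)
  exact Submodule.finiteDimensional_of_le hle

theorem finiteDimensional_range_mul_left {F : H →L[ℂ] H}
    (hF : FiniteDimensional ℂ (LinearMap.range (F : H →ₗ[ℂ] H))) (x : H →L[ℂ] H) :
    FiniteDimensional ℂ (LinearMap.range ((x * F : H →L[ℂ] H) : H →ₗ[ℂ] H)) := by
  have h : LinearMap.range ((x * F : H →L[ℂ] H) : H →ₗ[ℂ] H) =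
      (LinearMap.range (F : H →ₗ[ℂ] H)).map (x : H →ₗ[ℂ] H) := by
    rw [← LinearMap.range_comp]; rfl
  rw [h]
  infer_instance

theorem finiteDimensional_range_mul_right {F : H →L[ℂ] H}
    (hF : FiniteDimensional ℂ (LinearMap.range (F : H →ₗ[ℂ] H))) (x : H →L[ℂ] H) :
    FiniteDimensional ℂ (LinearMap.range ((F * x : H →L[ℂ] H) : H →ₗ[ℂ] H)) := by
  refine Submodule.finiteDimensional_of_le (S₂ := LinearMap.range (F : H →ₗ[ℂ] H)) ?_
  rintro _ ⟨v, rfl⟩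
  exact ⟨x v, rfl⟩

/-- `x` preserves the range of `R` and, if `R` is the inverse of `D`, then `[D, x]` is bounded. -/
def HasBoundedCommutator (R x : H →L[ℂ] H) (C : ℝ) : Prop :=
  ∀ y : H, ∃ z : H, x (R y) = R z ∧ ‖z - x y‖ ≤ C * ‖R y‖

/-- A Sylvester equation: with `G` inverting `R` on the range of `E`, the block `X = E * x * F`
satisfies `X = G X R F` up to a commutator term of norm at most `C * ρ`. As `‖G‖ * ‖R F‖ ≤ θ < 1`,
the term in `X` is absorbed on the left. The other block is treated in the same way. -/
theorem norm_block_le {R x E F G : H →L[ℂ] H} {C ρ M θ : ℝ} (hx : HasBoundedCommutator R x C)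
    (hC : 0 ≤ C) (hρ : 0 ≤ ρ) (hM : 0 ≤ M) (hθ : θ < 1) (hMρ : M * ρ ≤ θ) (hGR : G * R = E)
    (hRG : R * G = E) (hEG : E * G = G) (hGE : G * E = G) (hFF : F * F = F) (hRF : R * F = F * R)
    (hE1 : ‖E‖ ≤ 1) (hF : ‖R * F‖ ≤ ρ) (hG : ‖G‖ ≤ M) :
    ‖E * x * F‖ ≤ C * ρ / (1 - θ) ∧ ‖F * x * E‖ ≤ C * ρ / (1 - θ) := by
  have hfin : ∀ X : H →L[ℂ] H, (∀ y, ‖X y‖ ≤ (θ * ‖X‖ + C * ρ) * ‖y‖) → ‖X‖ ≤ C * ρ / (1 - θ) := by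
    intro X hX
    have hθ0 : 0 ≤ θ := (mul_nonneg hM hρ).trans hMρ
    have h1 := X.opNorm_le_bound (by positivity) hX
    rw [le_div_iff₀ (by linarith)]
    linarith
  constructor
  · refine hfin _ fun y => ?_
    obtain ⟨z, hz, hzn⟩ := hx (F y)
    have hRFy : ‖R (F y)‖ ≤ ρ * ‖y‖ := (R * F).le_of_opNorm_le hF y
    have h1 : E z = G ((E * x * F) (R (F y))) := by
      have e1 : F (R (F y)) = R (F y) := by
        have h2 : F * R * F = R * F := by rw [← hRF, mul_assoc, hFF]
        exact congrArg (fun S : H →L[ℂ] H => S y) h2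
      have e2 : ∀ w, G (E w) = G w := fun w => congrArg (fun S : H →L[ℂ] H => S w) hGE
      have e3 : ∀ w, G (R w) = E w := fun w => congrArg (fun S : H →L[ℂ] H => S w) hGR
      simp only [mul_apply_eq_comp, e1, e2, hz, e3]
    have h2 : (E * x * F) y = G ((E * x * F) (R (F y))) - E (z - x (F y)) := by
      rw [map_sub, h1]
      simp [mul_apply_eq_comp]
    rw [h2]
    calc _ ≤ ‖G ((E * x * F) (R (F y)))‖ + ‖E (z - x (F y))‖ := norm_sub_le _ _
      _ ≤ M * (‖E * x * F‖ * (ρ * ‖y‖)) + 1 * (C * (ρ * ‖y‖)) := by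
          gcongr
          · exact G.le_of_opNorm_le_of_le hG ((E * x * F).le_opNorm_of_le hRFy)
          · refine E.le_of_opNorm_le_of_le hE1 (hzn.trans ?_)
            gcongr
      _ = (M * ρ * ‖E * x * F‖ + C * ρ) * ‖y‖ := by ring
      _ ≤ _ := by gcongr
  · refine hfin _ fun y => ?_
    obtain ⟨z, hz, hzn⟩ := hx (G y)
    have e3 : R (G y) = E y := congrArg (fun S : H →L[ℂ] H => S y) hRG
    have e4 : ∀ w, F (R w) = R (F w) := fun w => congrArg (fun S : H →L[ℂ] H => S w) hRF.symm
    have e5 : ∀ w, F (F w) = F w := fun w => congrArg (fun S : H →L[ℂ] H => S w) hFF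
    have e6 : E (G y) = G y := congrArg (fun S : H →L[ℂ] H => S y) hEG
    have h2 : (F * x * E) y = (R * F) (z - x (G y)) + (R * F) ((F * x * E) (G y)) := by
      rw [← map_add]
      simp only [mul_apply_eq_comp, map_add, map_sub, e6, e5]
      rw [← e3, hz, e4]
      abel
    rw [e3] at hzn
    have hEy : ‖E y‖ ≤ 1 * ‖y‖ := E.le_of_opNorm_le hE1 y
    rw [h2]
    calc _ ≤ ‖(R * F) (z - x (G y))‖ + ‖(R * F) ((F * x * E) (G y))‖ := norm_add_le _ _
      _ ≤ ρ * (C * (1 * ‖y‖)) + ρ * (‖F * x * E‖ * (M * ‖y‖)) := by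
          gcongr
          · refine (R * F).le_of_opNorm_le_of_le hF (hzn.trans ?_)
            gcongr
          · exact (R * F).le_of_opNorm_le_of_le hF
              ((F * x * E).le_opNorm_of_le (G.le_of_opNorm_le hG y))
      _ = (M * ρ * ‖F * x * E‖ + C * ρ) * ‖y‖ := by ring
      _ ≤ _ := by gcongr

open Classical in
theorem norm_diagProj_block_le (b : HilbertBasis ι ℂ H) {R x : H →L[ℂ] H} {r : ι → ℝ}
    (hb : ∀ i, R (b i) = (r i : ℂ) • b i) {C : ℝ} (hx : HasBoundedCommutator R x C)
    (hC : 0 ≤ C) {θ ρ : ℝ} (hθ0 : 0 < θ) (hθ1 : θ < 1) (hρ : 0 < ρ) {S S' : Set ι}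
    (hS : ∀ i ∈ S, ρ ≤ θ * |r i|) (hS' : ∀ i ∈ S', |r i| ≤ ρ) :
    ‖diagProj b S * x * diagProj b S'‖ ≤ C * ρ / (1 - θ) ∧
      ‖diagProj b S' * x * diagProj b S‖ ≤ C * ρ / (1 - θ) := by
  have hg : ∀ i, ‖(if i ∈ S then ((r i)⁻¹ : ℝ) else 0 : ℂ)‖ ≤ θ / ρ := by
    intro i
    split_ifs with h
    · have h1 := hS i h
      have h2 : 0 < |r i| := by
        by_contra! h3
        nlinarith
      rw [Complex.norm_real, Real.norm_eq_abs, abs_inv, le_div_iff₀ hρ, inv_mul_le_iff₀ h2]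
      linarith
    · simp only [norm_zero]
      positivity
  have hG := diagonal_apply b (by positivity) hg
  set G := diagonal b fun i => (if i ∈ S then ((r i)⁻¹ : ℝ) else 0 : ℂ)
  have hne : ∀ i ∈ S, (r i : ℂ) ≠ 0 := by
    intro i hi h
    rw [Complex.ofReal_eq_zero] at h
    have := hS i hi
    rw [h, abs_zero, mul_zero] at this
    linarith
  refine norm_block_le (G := G) (M := θ / ρ) hx hC hρ.le (by positivity) hθ1
    (div_mul_cancel₀ θ hρ.ne').le ?_ ?_ ?_ ?_ ?_ ?_ (norm_diagProj_le b S) ?_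
    (norm_diagonal_le b (by positivity) hg)
  · refine clm_ext_hilbertBasis b fun i => ?_
    rw [mul_apply_eq_comp, hb, map_smul, hG, diagProj_apply, smul_smul]
    split_ifs with h
    · rw [Complex.ofReal_inv, mul_inv_cancel₀ (hne i h)]
    · rw [mul_zero]
  · refine clm_ext_hilbertBasis b fun i => ?_
    rw [mul_apply_eq_comp, hG, map_smul, hb, diagProj_apply, smul_smul]
    split_ifs with h
    · rw [Complex.ofReal_inv, inv_mul_cancel₀ (hne i h)]
    · rw [zero_mul]
  · refine clm_ext_hilbertBasis b fun i => ?_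
    rw [mul_apply_eq_comp, hG, map_smul, diagProj_apply, smul_smul]
    split_ifs <;> simp
  · refine clm_ext_hilbertBasis b fun i => ?_
    rw [mul_apply_eq_comp, diagProj_apply, map_smul, hG, smul_smul]
    split_ifs <;> simp
  · refine clm_ext_hilbertBasis b fun i => ?_
    rw [mul_apply_eq_comp, diagProj_apply, map_smul, diagProj_apply, smul_smul]
    split_ifs <;> simp
  · refine clm_ext_hilbertBasis b fun i => ?_
    rw [mul_apply_eq_comp, mul_apply_eq_comp, diagProj_apply, map_smul, hb, map_smul,
      diagProj_apply, smul_smul, smul_smul, mul_comm]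
  · refine norm_le_of_diagonal b (g := fun i => (if i ∈ S' then 1 else 0) * (r i : ℂ)) hρ.le
      (fun i => ?_) fun i => ?_
    · split_ifs with h
      · rw [one_mul, Complex.norm_real]
        exact hS' i h
      · simpa using hρ.le
    · rw [mul_apply_eq_comp, diagProj_apply, map_smul, hb, smul_smul]

end Band

/-! ### Reduction to band operators. -/

section Decomposition

variable {H : Type*} [NormedAddCommGroup H] [InnerProductSpace ℂ H] [CompleteSpace H] {ι : Type*}

/-- An operator with bounded commutator is a band operator with respect to the geometric grading `κ`
of the spectrum, up to operators that are invisible to functionals vanishing on finite rank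
operators. -/
theorem exists_band_approx (b : HilbertBasis ι ℂ H) {R x : H →L[ℂ] H} {r : ι → ℝ}
    (hb : ∀ i, R (b i) = (r i : ℂ) • b i) {C : ℝ} (hx : HasBoundedCommutator R x C)
    (hC : 0 ≤ C) {θ M : ℝ} (hθ0 : 0 < θ) (hθ1 : θ < 1) (hM : 0 < M) {κ : ι → ℕ}
    (hκ : ∀ i, θ ^ (κ i + 1) * M < |r i| ∧ |r i| ≤ θ ^ κ i * M)
    (hfin : ∀ n, {i | κ i ≤ n}.Finite) :
    ∃ x' : H →L[ℂ] H, ‖x'‖ ≤ ‖x‖ + 1 ∧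
      (∀ i j, κ i + 2 ≤ κ j ∨ κ j + 2 ≤ κ i → ⟪b i, x' (b j)⟫_ℂ = 0) ∧
      ∀ ψ : (H →L[ℂ] H) →L[ℂ] ℂ,
        (∀ y : H →L[ℂ] H, FiniteDimensional ℂ (LinearMap.range (y : H →ₗ[ℂ] H)) → ψ y = 0) →
        ∀ a, ψ (a * x) = ψ (a * x') ∧ ψ (x * a) = ψ (x' * a) := by
  classical
  have hθ' : 0 < 1 - θ := by linarith
  set K : ℝ := 2 * (C * M / (1 - θ)) with hK
  have hK0 : 0 ≤ K := by positivity
  -- Levels below `L` have finite rank and cost nothing under `ψ`. Discarding them makes the removed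
  -- blocks sum to norm at most 1, so the bound on `x'` does not depend on `θ`.
  obtain ⟨L, hL⟩ := exists_pow_lt_of_lt_one (show 0 < (1 - θ) / (K + 1) by positivity) hθ1
  have hKL : K * θ ^ L * (1 - θ)⁻¹ ≤ 1 := by
    rw [lt_div_iff₀ (by positivity)] at hL
    rw [mul_inv_le_iff₀ hθ', one_mul]
    have : 0 ≤ θ ^ L := by positivity
    nlinarith
  set E : ℕ → H →L[ℂ] H := fun l => diagProj b {i | L ≤ κ i ∧ κ i + 2 ≤ l + L} with hE
  set F : ℕ → H →L[ℂ] H := fun l => diagProj b {i | κ i = l + L} with hF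
  set Y : ℕ → H →L[ℂ] H := fun l => E l * x * F l + F l * x * E l with hY
  have hYn : ∀ l, ‖Y l‖ ≤ K * θ ^ L * θ ^ l := by
    intro l
    have h1 := norm_diagProj_block_le b hb hx hC hθ0 hθ1 (ρ := θ ^ (l + L) * M) (by positivity)
      (S := {i | L ≤ κ i ∧ κ i + 2 ≤ l + L}) (S' := {i | κ i = l + L})
      (fun i hi => by
        calc θ ^ (l + L) * M ≤ θ ^ (κ i + 2) * M := by
              gcongr ?_ * M
              exact pow_le_pow_of_le_one hθ0.le hθ1.le hi.2
          _ = θ * (θ ^ (κ i + 1) * M) := by ring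
          _ ≤ θ * |r i| := by
              gcongr
              exact (hκ i).1.le)
      (fun i hi => by
        rw [← (show κ i = l + L from hi)]
        exact (hκ i).2)
    refine (norm_add_le_of_le h1.1 h1.2).trans (le_of_eq ?_)
    rw [hK, pow_add]
    ring
  have hgeo : HasSum (fun l => K * θ ^ L * θ ^ l) (K * θ ^ L * (1 - θ)⁻¹) :=
    (hasSum_geometric_of_lt_one hθ0.le hθ1).mul_left _
  have hYsum : Summable Y := Summable.of_norm_bounded hgeo.summable hYn
  set N := ∑' l, Y l with hN
  have hN1 : ‖N‖ ≤ 1 := (tsum_of_norm_bounded hgeo hYn).trans hKL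
  set P := diagProj b {i | L ≤ κ i} with hP
  set Q := diagProj b {i | κ i < L} with hQ
  have hPQ : (1 : H →L[ℂ] H) = P + Q := by
    refine clm_ext_hilbertBasis b fun i => ?_
    rw [add_apply, hP, hQ, diagProj_apply, diagProj_apply, ← add_smul]
    by_cases h : L ≤ κ i
    · simp [h, not_lt.2 h]
    · simp [h, not_le.1 h]
  have hQf : FiniteDimensional ℂ (LinearMap.range (Q : H →ₗ[ℂ] H)) :=
    finiteDimensional_range_diagProj b ((hfin L).subset fun i (hi : κ i < L) => hi.le)
  have hFf : ∀ l, FiniteDimensional ℂ (LinearMap.range (F l : H →ₗ[ℂ] H)) := fun l =>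
    finiteDimensional_range_diagProj b
      ((hfin (l + L)).subset fun i (hi : κ i = l + L) => hi.le)
  refine ⟨P * x * P - N, ?_, ?_, ?_⟩
  · refine norm_sub_le_of_le ?_ hN1
    calc ‖P * x * P‖ ≤ ‖P‖ * ‖x‖ * ‖P‖ :=
          (norm_mul_le _ _).trans (by gcongr; exact norm_mul_le _ _)
      _ ≤ 1 * ‖x‖ * 1 := by
          gcongr <;> exact norm_diagProj_le b _
      _ = ‖x‖ := by ring
  · intro i j hij
    have h1 : HasSum (fun l => ⟪b i, (Y l) (b j)⟫_ℂ) ⟪b i, N (b j)⟫_ℂ :=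
      (hYsum.hasSum.mapL (ContinuousLinearMap.apply ℂ H (b j))).mapL (innerSL ℂ (b i))
    have h2 : ∀ l, ⟪b i, (Y l) (b j)⟫_ℂ =
        (if (L ≤ κ i ∧ κ i + 2 ≤ l + L) ∧ κ j = l + L then ⟪b i, x (b j)⟫_ℂ else 0) +
        (if κ i = l + L ∧ (L ≤ κ j ∧ κ j + 2 ≤ l + L) then ⟪b i, x (b j)⟫_ℂ else 0) := by
      intro l
      rw [hY]
      simp only [add_apply, inner_add_right]
      exact congrArg₂ (· + ·) (inner_diagProj_mul_mul b _ _ x i j Iff.rfl)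
        (inner_diagProj_mul_mul b _ _ x i j Iff.rfl)
    have h3 : ⟪b i, (P * x * P) (b j)⟫_ℂ =
        if L ≤ κ i ∧ L ≤ κ j then ⟪b i, x (b j)⟫_ℂ else 0 :=
      inner_diagProj_mul_mul b _ _ x i j Iff.rfl
    rw [sub_apply, inner_sub_right, h3, sub_eq_zero]
    -- A pair of levels, both at least `L` and two or more apart, occurs in exactly one `Y l`: the
    -- one for which `l + L` is the larger level.
    refine HasSum.unique ?_ h1
    split_ifs with hl
    · rcases hij with hij | hij
      · convert hasSum_single (κ j - L) fun l hlne => ?_ using 1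
        · rw [h2, if_pos (by omega), if_neg (by omega), add_zero]
        · rw [h2, if_neg (by omega), if_neg (by omega), add_zero]
      · convert hasSum_single (κ i - L) fun l hlne => ?_ using 1
        · rw [h2, if_neg (by omega), if_pos (by omega), zero_add]
        · rw [h2, if_neg (by omega), if_neg (by omega), add_zero]
    · convert hasSum_zero with l
      rw [h2, if_neg (by omega), if_neg (by omega), add_zero]
  · intro ψ hψ a
    -- `N` is a norm convergent series of finite rank operators, and `ψ` is continuous.
    have hNl : ψ (a * N) = 0 := by
      refine ((hYsum.hasSum.mul_left a).mapL ψ).unique ?_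
      convert hasSum_zero with l
      rw [hY]
      simp only [mul_add, map_add]
      rw [hψ, hψ, add_zero]
      · exact finiteDimensional_range_mul_left (finiteDimensional_range_mul_right
          (finiteDimensional_range_mul_right (hFf l) _) _) _
      · exact finiteDimensional_range_mul_left (finiteDimensional_range_mul_left (hFf l) _) _
    have hNr : ψ (N * a) = 0 := by
      refine ((hYsum.hasSum.mul_right a).mapL ψ).unique ?_
      convert hasSum_zero with l
      rw [hY]
      simp only [add_mul, map_add]
      rw [hψ, hψ, add_zero]
      · exact finiteDimensional_range_mul_right (finiteDimensional_range_mul_right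
          (finiteDimensional_range_mul_right (hFf l) _) _) _
      · exact finiteDimensional_range_mul_right (finiteDimensional_range_mul_left (hFf l) _) _
    have hdec : x = P * x * P + Q * x + P * x * Q := by
      calc x = (P + Q) * x := by rw [← hPQ, one_mul]
        _ = P * x * 1 + Q * x := by rw [add_mul, mul_one]
        _ = P * x * (P + Q) + Q * x := by rw [← hPQ]
        _ = _ := by rw [mul_add]; abel
    have e1 : ψ (a * (Q * x)) = 0 :=
      hψ _ (finiteDimensional_range_mul_left (finiteDimensional_range_mul_right hQf _) _)
    have e2 : ψ (a * (P * x * Q)) = 0 :=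
      hψ _ (finiteDimensional_range_mul_left (finiteDimensional_range_mul_left hQf _) _)
    have e3 : ψ (Q * x * a) = 0 :=
      hψ _ (finiteDimensional_range_mul_right (finiteDimensional_range_mul_right hQf _) _)
    have e4 : ψ (P * x * Q * a) = 0 :=
      hψ _ (finiteDimensional_range_mul_right (finiteDimensional_range_mul_left hQf _) _)
    constructor
    · conv_lhs => rw [hdec]
      rw [mul_add, mul_add, map_add, map_add, e1, e2, mul_sub, map_sub, hNl]
      ring
    · conv_lhs => rw [hdec]
      rw [add_mul, add_mul, map_add, map_add, e3, e4, sub_mul, map_sub, hNr]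
      ring

end Decomposition

/-! ### Near-commutation with `T` for homogeneous operators. -/

section Twist

variable {H : Type*} [NormedAddCommGroup H] [InnerProductSpace ℂ H] {ι : Type*}

/-- Write `t i = A * g ^ (-κ i) / q i` with `1 ≤ q i ≤ g`. When `X` shifts the grading by exactly
`m`, conjugation by `T` multiplies its `(i, j)` entry by `g ^ (-m) * q j / q i`, that is, `T * X =
(G' * X * G) * T` with diagonal `G` and `G'` near 1. The twist turns the commutator into `ψ (a * (X
- G' * X * G))`, and the error is `(g ^ 2 - 1) * g + (g - 1) = g ^ 3 - 1`. -/
theorem norm_apply_commutator_le_of_homogeneous (b : HilbertBasis ι ℂ H) {T : H →L[ℂ] H}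
    {t : ι → ℝ} (hT : ∀ i, T (b i) = (t i : ℂ) • b i) {ψ : (H →L[ℂ] H) →L[ℂ] ℂ}
    (hψ : ∀ a v w : H →L[ℂ] H, T * v = w * T → ψ (a * w) = ψ (v * a)) {g A : ℝ} (hg : 1 ≤ g)
    (hA : 0 < A) {κ : ι → ℕ} (hκ : ∀ i, A < t i * g ^ (κ i + 1) ∧ t i * g ^ κ i ≤ A)
    {X : H →L[ℂ] H} {m : ℤ} (hm : |m| ≤ 1)
    (hX : ∀ i j, ⟪b i, X (b j)⟫_ℂ ≠ 0 → (κ i : ℤ) - κ j = m) (a : H →L[ℂ] H) :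
    ‖ψ (a * X) - ψ (X * a)‖ ≤ ‖ψ‖ * ‖a‖ * (‖X‖ * (g ^ 3 - 1)) := by
  have hg0 : 0 < g := by linarith
  have ht : ∀ i, 0 < t i := fun i => by
    have h1 := (hκ i).1
    by_contra! h
    have : 0 < g ^ (κ i + 1) := by positivity
    nlinarith
  set q : ι → ℝ := fun i => A / (t i * g ^ κ i) with hq
  have hq1 : ∀ i, 1 ≤ q i := fun i => by
    have := ht i
    rw [hq, one_le_div (by positivity)]
    exact (hκ i).2
  have hqg : ∀ i, q i ≤ g := fun i => by
    have := ht i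
    rw [hq, div_le_iff₀ (by positivity)]
    have := (hκ i).1
    rw [pow_succ] at this
    linarith
  set c : ℝ := g ^ (-m) with hc
  have hc0 : 0 < c := by positivity
  have hcg : c ≤ g := by
    calc c ≤ g ^ (1 : ℤ) := zpow_le_zpow_right₀ hg (by have := (abs_le.1 hm).1; omega)
      _ = g := zpow_one g
  have hcg' : g⁻¹ ≤ c := by
    calc g⁻¹ = g ^ (-1 : ℤ) := (zpow_neg_one g).symm
      _ ≤ c := zpow_le_zpow_right₀ hg (by have := (abs_le.1 hm).2; omega)
  have hqn : ∀ i, ‖((q i : ℝ) : ℂ)‖ ≤ g := fun i => by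
    rw [Complex.norm_real, Real.norm_of_nonneg (by linarith [hq1 i])]
    exact hqg i
  have hcqn : ∀ i, ‖((c / q i : ℝ) : ℂ)‖ ≤ g := fun i => by
    have := hq1 i
    rw [Complex.norm_real, Real.norm_of_nonneg (by positivity)]
    exact (div_le_self hc0.le this).trans hcg
  set G := diagonal b fun i => ((q i : ℝ) : ℂ) with hG
  set G' := diagonal b fun i => ((c / q i : ℝ) : ℂ) with hG'
  have hGb : ∀ i, G (b i) = ((q i : ℝ) : ℂ) • b i := diagonal_apply b hg0.le hqn
  have hG'b : ∀ i, G' (b i) = ((c / q i : ℝ) : ℂ) • b i := diagonal_apply b hg0.le hcqn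
  have hG1 : ‖G - 1‖ ≤ g - 1 := by
    refine norm_le_of_diagonal b (g := fun i => ((q i - 1 : ℝ) : ℂ)) (by linarith) (fun i => ?_)
      fun i => ?_
    · rw [Complex.norm_real, Real.norm_of_nonneg (by linarith [hq1 i])]
      linarith [hqg i]
    · rw [sub_apply, hGb, one_apply_eq_self, Complex.ofReal_sub, sub_smul, Complex.ofReal_one,
        one_smul]
  have hG'1 : ‖G' - 1‖ ≤ g ^ 2 - 1 := by
    refine norm_le_of_diagonal b (g := fun i => ((c / q i - 1 : ℝ) : ℂ)) (by nlinarith)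
      (fun i => ?_) fun i => ?_
    · have h1 := hq1 i
      have h2 : c / q i ≤ g := (div_le_self hc0.le h1).trans hcg
      have h3 : (g ^ 2)⁻¹ ≤ c / q i := by
        rw [le_div_iff₀ (by linarith), inv_mul_le_iff₀ (by positivity)]
        rw [inv_le_iff_one_le_mul₀ hg0] at hcg'
        nlinarith [hqg i]
      have h4 : 1 - (g ^ 2)⁻¹ ≤ g ^ 2 - 1 := by
        have h5 : 0 < g ^ 2 := by positivity
        have h6 : g ^ 2 * (g ^ 2)⁻¹ = 1 := mul_inv_cancel₀ h5.ne'
        nlinarith [sq_nonneg (g ^ 2 - 1), inv_pos.2 h5]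
      rw [Complex.norm_real, Real.norm_eq_abs, abs_le]
      constructor
      · linarith
      · nlinarith
    · rw [sub_apply, hG'b, one_apply_eq_self, Complex.ofReal_sub, sub_smul, Complex.ofReal_one,
        one_smul]
  have hGn : ‖G‖ ≤ g := norm_diagonal_le b hg0.le hqn
  have htw : T * X = (G' * X * G) * T := by
    refine clm_ext_inner b fun i j => ?_
    simp only [mul_apply_eq_comp, hT, hGb, map_smul, inner_smul_right,
      inner_apply_of_diagonal b hT, inner_apply_of_diagonal b hG'b]
    by_cases h : ⟪b i, X (b j)⟫_ℂ = 0
    · simp [h]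
    · have h1 : (t i : ℝ) = t j * (q j * (c / q i)) := by
        have hti := (ht i).ne'
        have htj := (ht j).ne'
        have hκij : g ^ κ i = g ^ κ j * g ^ m := by
          rw [← zpow_natCast, ← zpow_natCast, ← zpow_add₀ hg0.ne']
          congr 1
          have := hX i j h
          omega
        have hgm : g ^ m ≠ 0 := by positivity
        rw [hc, hq, zpow_neg]
        simp only
        rw [hκij]
        field_simp
      rw [h1]
      push_cast
      ring
  rw [← hψ a X _ htw, ← map_sub, ← mul_sub]
  refine (ψ.le_opNorm _).trans ?_
  rw [mul_assoc ‖ψ‖]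
  refine mul_le_mul_of_nonneg_left ((norm_mul_le _ _).trans ?_) (norm_nonneg _)
  refine mul_le_mul_of_nonneg_left ?_ (norm_nonneg _)
  have h1 : X - G' * X * G = -((G' - 1) * X * G + X * (G - 1)) := by noncomm_ring
  rw [h1, norm_neg]
  calc _ ≤ ‖(G' - 1) * X * G‖ + ‖X * (G - 1)‖ := norm_add_le _ _
    _ ≤ (g ^ 2 - 1) * ‖X‖ * g + ‖X‖ * (g - 1) := by
        exact add_le_add (norm_mul_le_of_le (norm_mul_le_of_le hG'1 le_rfl) hGn)
          (norm_mul_le_of_le le_rfl hG1)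
    _ = _ := by ring

end Twist

/-! ### Vanishing of the functional on commutators. -/

section Commutator

variable {H : Type*} [NormedAddCommGroup H] [InnerProductSpace ℂ H] {ι : Type*}

/-- For levels at distance at most 1, the residues modulo 3 determine the signed difference. Cutting
by residues therefore splits a band operator into nine homogeneous pieces, none of larger norm. -/
theorem norm_apply_commutator_le_of_band (b : HilbertBasis ι ℂ H) {T : H →L[ℂ] H}
    {t : ι → ℝ} (hT : ∀ i, T (b i) = (t i : ℂ) • b i) {ψ : (H →L[ℂ] H) →L[ℂ] ℂ}
    (hψ : ∀ a v w : H →L[ℂ] H, T * v = w * T → ψ (a * w) = ψ (v * a)) {g A : ℝ} (hg : 1 ≤ g)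
    (hA : 0 < A) {κ : ι → ℕ} (hκ : ∀ i, A < t i * g ^ (κ i + 1) ∧ t i * g ^ κ i ≤ A)
    {x : H →L[ℂ] H} (hx : ∀ i j, κ i + 2 ≤ κ j ∨ κ j + 2 ≤ κ i → ⟪b i, x (b j)⟫_ℂ = 0)
    (a : H →L[ℂ] H) :
    ‖ψ (a * x) - ψ (x * a)‖ ≤ 9 * (‖ψ‖ * ‖a‖ * (‖x‖ * (g ^ 3 - 1))) := by
  classical
  set F : ℕ → H →L[ℂ] H := fun s => diagProj b {i | κ i % 3 = s} with hF
  have h1 : ∑ s ∈ Finset.range 3, F s = 1 := by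
    refine clm_ext_hilbertBasis b fun i => ?_
    rw [sum_apply, one_apply_eq_self, Finset.sum_eq_single_of_mem (κ i % 3)
      (Finset.mem_range.2 (Nat.mod_lt _ (by norm_num)))]
    · rw [hF, diagProj_apply, if_pos (show i ∈ {i' | κ i' % 3 = κ i % 3} from rfl), one_smul]
    · intro s _ hs
      rw [hF, diagProj_apply, if_neg fun h => hs h.symm, zero_smul]
  have hdec : x = ∑ s ∈ Finset.range 3, ∑ r ∈ Finset.range 3, F s * x * F r := by
    simp only [← Finset.mul_sum, h1, mul_one, ← Finset.sum_mul, one_mul]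
  have hsum : ψ (a * x) - ψ (x * a) = ∑ s ∈ Finset.range 3, ∑ r ∈ Finset.range 3,
      (ψ (a * (F s * x * F r)) - ψ (F s * x * F r * a)) := by
    conv_lhs => rw [hdec]
    simp only [Finset.mul_sum, Finset.sum_mul, map_sum, Finset.sum_sub_distrib]
  rw [hsum]
  have hg3 : 0 ≤ g ^ 3 - 1 := by linarith [one_le_pow₀ hg (n := 3)]
  have hle : ∀ s ∈ Finset.range 3, ∀ r ∈ Finset.range 3,
      ‖ψ (a * (F s * x * F r)) - ψ (F s * x * F r * a)‖ ≤
        ‖ψ‖ * ‖a‖ * (‖x‖ * (g ^ 3 - 1)) := by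
    intro s hs r hr
    rw [Finset.mem_range] at hs hr
    obtain ⟨m, hm, hms⟩ : ∃ m : ℤ, |m| ≤ 1 ∧ ∀ p q : ℕ, p % 3 = s → q % 3 = r →
        ¬ (p + 2 ≤ q ∨ q + 2 ≤ p) → (p : ℤ) - q = m := by
      refine ⟨if s = r then 0 else if (r + 1) % 3 = s then 1 else -1, ?_, ?_⟩
      · split_ifs <;> simp
      · intro p q hp hq hpq
        split_ifs <;> omega
    refine (norm_apply_commutator_le_of_homogeneous b hT hψ hg hA hκ hm (fun i j hij => ?_)
      a).trans ?_
    · rw [hF] at hij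
      simp only at hij
      rw [inner_diagProj_mul_mul b _ _ x i j Iff.rfl] at hij
      split_ifs at hij with h
      · exact hms _ _ h.1 h.2 fun h' => hij (hx i j h')
      · exact absurd rfl hij
    · gcongr
      calc ‖F s * x * F r‖ ≤ 1 * ‖x‖ * 1 :=
            norm_mul_le_of_le (norm_mul_le_of_le (norm_diagProj_le b _) le_rfl)
              (norm_diagProj_le b _)
        _ = ‖x‖ := by ring
  calc _ ≤ ∑ s ∈ Finset.range 3, ∑ r ∈ Finset.range 3, ‖ψ‖ * ‖a‖ * (‖x‖ * (g ^ 3 - 1)) :=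
        norm_sum_le_of_le _ fun s hs => norm_sum_le_of_le _ fun r hr => hle s hs r hr
    _ = _ := by
        simp only [Finset.sum_const, Finset.card_range, nsmul_eq_mul]
        push_cast
        ring

/-- For each `θ < 1` replace `x` by a band operator and apply the band estimate with `g = θ ^ (-d)`.
The band operator depends on `θ`, but its norm stays below `‖x‖ + 1`, so the bound tends to zero as
`θ → 1`. -/
theorem apply_mul_comm_of_hasBoundedCommutator [CompleteSpace H] (b : HilbertBasis ι ℂ H)
    {R T x : H →L[ℂ] H} {r : ι → ℝ} (hb : ∀ i, R (b i) = (r i : ℂ) • b i) (hr : ∀ i, r i ≠ 0)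
    (hfin : ∀ s : ℝ, 0 < s → {i | s < |r i|}.Finite) {d : ℝ} (hd : 0 < d)
    (hT : ∀ i, T (b i) = ((|r i| ^ d : ℝ) : ℂ) • b i) {ψ : (H →L[ℂ] H) →L[ℂ] ℂ}
    (hψ0 : ∀ y : H →L[ℂ] H, FiniteDimensional ℂ (LinearMap.range (y : H →ₗ[ℂ] H)) → ψ y = 0)
    (hψ : ∀ a v w : H →L[ℂ] H, T * v = w * T → ψ (a * w) = ψ (v * a))
    {C : ℝ} (hC : 0 ≤ C) (hx : HasBoundedCommutator R x C) (a : H →L[ℂ] H) :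
    ψ (a * x) = ψ (x * a) := by
  set M := ‖R‖ + 1 with hM
  have hM0 : 0 < M := by positivity
  have hrM : ∀ i, |r i| ≤ M := by
    intro i
    have h1 := R.le_opNorm (b i)
    rw [hb, norm_smul, b.orthonormal.1, mul_one, mul_one, Complex.norm_real] at h1
    exact h1.trans (by rw [hM]; linarith)
  have hbound : ∀ θ ∈ Set.Ioo (0 : ℝ) 1, ‖ψ (a * x) - ψ (x * a)‖ ≤
      9 * (‖ψ‖ * ‖a‖ * ((‖x‖ + 1) * ((θ ^ d)⁻¹ ^ 3 - 1))) := by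
    rintro θ ⟨hθ0, hθ1⟩
    have hκ : ∀ i, ∃ n : ℕ, θ ^ (n + 1) * M < |r i| ∧ |r i| ≤ θ ^ n * M := by
      intro i
      obtain ⟨n, h1, h2⟩ := exists_nat_pow_near_of_lt_one
        (div_pos (abs_pos.2 (hr i)) hM0) ((div_le_one hM0).2 (hrM i)) hθ0 hθ1
      exact ⟨n, (lt_div_iff₀ hM0).1 h1, (div_le_iff₀ hM0).1 h2⟩
    choose κ hκ using hκ
    have hκfin : ∀ n, {i | κ i ≤ n}.Finite := fun n =>
      (hfin (θ ^ (n + 1) * M) (by positivity)).subset fun i (hi : κ i ≤ n) => by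
        refine lt_of_le_of_lt ?_ (hκ i).1
        gcongr ?_ * M
        exact pow_le_pow_of_le_one hθ0.le hθ1.le (by omega)
    obtain ⟨x', hx'n, hx'b, hx'ψ⟩ := exists_band_approx b hb hx hC hθ0 hθ1 hM0 hκ hκfin
    rw [(hx'ψ ψ hψ0 a).1, (hx'ψ ψ hψ0 a).2]
    have hθd : 0 < θ ^ d := Real.rpow_pos_of_pos hθ0 d
    have hg : 1 ≤ (θ ^ d)⁻¹ := (one_le_inv₀ hθd).2 (Real.rpow_le_one hθ0.le hθ1.le hd.le)
    have hpow : ∀ n : ℕ, (θ ^ n * M) ^ d = (θ ^ d) ^ n * M ^ d := by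
      intro n
      rw [Real.mul_rpow (by positivity) hM0.le, ← Real.rpow_natCast, ← Real.rpow_natCast,
        ← Real.rpow_mul hθ0.le, ← Real.rpow_mul hθ0.le,
        mul_comm (n : ℝ) d]
    refine (norm_apply_commutator_le_of_band b hT hψ hg (A := M ^ d) (κ := κ)
      (Real.rpow_pos_of_pos hM0 d) (fun i => ⟨?_, ?_⟩) hx'b a).trans ?_
    · rw [inv_pow, ← div_eq_mul_inv, lt_div_iff₀ (by positivity), mul_comm, ← hpow]
      exact Real.rpow_lt_rpow (by positivity) (hκ i).1 hd
    · rw [inv_pow, ← div_eq_mul_inv, div_le_iff₀ (by positivity), mul_comm (M ^ d), ← hpow]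
      exact Real.rpow_le_rpow (abs_nonneg _) (hκ i).2 hd.le
    · have hg3 : 0 ≤ (θ ^ d)⁻¹ ^ 3 - 1 := by linarith [one_le_pow₀ hg (n := 3)]
      gcongr
  have hcont : ContinuousAt (fun θ : ℝ =>
      9 * (‖ψ‖ * ‖a‖ * ((‖x‖ + 1) * ((θ ^ d)⁻¹ ^ 3 - 1)))) 1 := by
    have h1 : ContinuousAt (fun θ : ℝ => θ ^ d) 1 :=
      Real.continuousAt_rpow_const _ _ (Or.inl one_ne_zero)
    have h2 : ContinuousAt (fun θ : ℝ => (θ ^ d)⁻¹) 1 := h1.inv₀ (by simp)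
    fun_prop
  have hlim := hcont.tendsto.mono_left (nhdsWithin_le_nhds (s := Set.Iio 1))
  simp only [Real.one_rpow, inv_one, one_pow, sub_self, mul_zero] at hlim
  have h0 : ‖ψ (a * x) - ψ (x * a)‖ ≤ 0 :=
    ge_of_tendsto hlim (by
      filter_upwards [Ioo_mem_nhdsLT (show (0 : ℝ) < 1 by norm_num)] with θ hθ using hbound θ hθ)
  exact sub_eq_zero.1 (norm_le_zero_iff.1 h0)

end Commutator

/-! ### The functional `x ↦ τ (x T)` on `B(H)`. -/

section State

variable {H : Type*} [NormedAddCommGroup H] [InnerProductSpace ℂ H]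

theorem traceFunctional_id_apply {T : H →L[ℂ] H} (τ : idealGen T →ₗ[ℂ] ℂ) (x : H →L[ℂ] H) :
    traceFunctional (AlgHom.id ℂ (H →L[ℂ] H)) T τ x =
      τ ⟨x * T, mul_mem_idealGen x (self_mem_idealGen T)⟩ := rfl

/-- `τ (a w T) = τ (a T v) = τ (v a T)`. -/
theorem IsSingularTrace.twist {T : H →L[ℂ] H} {τ : idealGen T →ₗ[ℂ] ℂ} (hτ : IsSingularTrace T τ)
    {a v w : H →L[ℂ] H} (h : T * v = w * T) :
    traceFunctional (AlgHom.id ℂ (H →L[ℂ] H)) T τ (a * w) =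
      traceFunctional (AlgHom.id ℂ (H →L[ℂ] H)) T τ (v * a) := by
  have h1 := hτ.trace v ⟨a * T, mul_mem_idealGen a (self_mem_idealGen T)⟩
  rw [traceFunctional_id_apply, traceFunctional_id_apply]
  simp only [mul_assoc] at h1 ⊢
  rw [h1]
  simp only [h]

theorem IsSingularTrace.traceFunctional_of_finiteRank {T : H →L[ℂ] H} {τ : idealGen T →ₗ[ℂ] ℂ}
    (hτ : IsSingularTrace T τ) {y : H →L[ℂ] H}
    (hy : FiniteDimensional ℂ (LinearMap.range (y : H →ₗ[ℂ] H))) :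
    traceFunctional (AlgHom.id ℂ (H →L[ℂ] H)) T τ y = 0 :=
  hτ.singular _ (finiteDimensional_range_mul_right hy T)

variable [CompleteSpace H]

/-- The trace property symmetrises the product: `τ (x T) = τ (√x T √x)`, and the last operator is
positive. -/
theorem IsSingularTrace.traceFunctional_nonneg {T : H →L[ℂ] H} (hT : 0 ≤ T)
    {τ : idealGen T →ₗ[ℂ] ℂ} (hτ : IsSingularTrace T τ) {x : H →L[ℂ] H} (hx : 0 ≤ x) :
    0 ≤ traceFunctional (AlgHom.id ℂ (H →L[ℂ] H)) T τ x := by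
  have hs := CFC.sqrt_mul_sqrt_self x hx
  have hs0 : IsSelfAdjoint (CFC.sqrt x) := (CFC.sqrt_nonneg x).isSelfAdjoint
  have h1 := hτ.trace (CFC.sqrt x)
    ⟨CFC.sqrt x * T, mul_mem_idealGen _ (self_mem_idealGen T)⟩
  simp only [← mul_assoc, hs] at h1
  rw [traceFunctional_id_apply, h1]
  apply hτ.nonneg
  rw [← ContinuousLinearMap.nonneg_iff_isPositive]
  exact hs0.conjugate_nonneg hT

/-- Positive functionals on a C⋆-algebra are automatically bounded, so no continuity of `τ` on the
ideal has to be assumed. -/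
theorem IsSingularTrace.exists_continuous {T : H →L[ℂ] H} (hT : 0 ≤ T)
    {τ : idealGen T →ₗ[ℂ] ℂ} (hτ : IsSingularTrace T τ) :
    ∃ ψ : (H →L[ℂ] H) →L[ℂ] ℂ,
      ∀ x, ψ x = traceFunctional (AlgHom.id ℂ (H →L[ℂ] H)) T τ x := by
  obtain ⟨C, hC⟩ := PositiveLinearMap.exists_norm_apply_le
    (PositiveLinearMap.mk₀ (traceFunctional (AlgHom.id ℂ (H →L[ℂ] H)) T τ)
      fun x hx => hτ.traceFunctional_nonneg hT hx)
  exact ⟨LinearMap.mkContinuous _ C hC, fun x => rfl⟩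

end State

/-! ### Properties of `D` expressed through its bounded inverse. -/

section SpectralTriple

variable {H : Type*} [NormedAddCommGroup H] [InnerProductSpace ℂ H]

theorem IsResolventAt.exists_mem_domain {D : H →ₗ.[ℂ] H} {R : H →L[ℂ] H}
    (hR : IsResolventAt D 0 R) (x : H) : ∃ h : R x ∈ D.domain, D ⟨R x, h⟩ = x := by
  obtain ⟨h, hx⟩ := hR.1 x
  exact ⟨h, by rwa [zero_smul, sub_zero] at hx⟩

theorem IsResolventAt.apply_apply {D : H →ₗ.[ℂ] H} {R : H →L[ℂ] H}
    (hR : IsResolventAt D 0 R) (x : D.domain) : R (D x) = x := by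
  have h := hR.2 x
  rwa [zero_smul, sub_zero] at h

theorem IsResolventAt.injective {D : H →ₗ.[ℂ] H} {R : H →L[ℂ] H}
    (hR : IsResolventAt D 0 R) : Function.Injective R := by
  rw [injective_iff_map_eq_zero]
  intro x hx
  obtain ⟨h, hDx⟩ := hR.exists_mem_domain x
  have h0 : (⟨R x, h⟩ : D.domain) = 0 := Subtype.ext hx
  rw [← hDx, h0, LinearPMap.map_zero]

theorem IsResolventAt.isSymmetric [CompleteSpace H] {D : H →ₗ.[ℂ] H} (hD : IsSelfAdjoint D)
    {R : H →L[ℂ] H} (hR : IsResolventAt D 0 R) : (R : H →ₗ[ℂ] H).IsSymmetric := by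
  intro x y
  obtain ⟨hx, hDx⟩ := hR.exists_mem_domain x
  obtain ⟨hy, hDy⟩ := hR.exists_mem_domain y
  have h1 := LinearPMap.adjoint_isFormalAdjoint hD.dense_domain
  rw [LinearPMap.isSelfAdjoint_def.1 hD] at h1
  have h2 := h1 ⟨R x, hx⟩ ⟨R y, hy⟩
  rw [hDx, hDy] at h2
  exact h2.symm

/-- The resolvent identity `R = S (1 - z R)` transfers compactness from `S` to `R`. -/
theorem IsResolventAt.isCompactOperator {D : H →ₗ.[ℂ] H} (hD : HasCompactResolvent D)
    {R : H →L[ℂ] H} (hR : IsResolventAt D 0 R) : IsCompactOperator R := by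
  obtain ⟨z, S, hS, hc⟩ := hD
  have h : R = S.comp (1 - z • R) := by
    ext x
    obtain ⟨hx, hDx⟩ := hR.exists_mem_domain x
    have h1 := hS.2 ⟨R x, hx⟩
    rw [hDx] at h1
    simpa using h1.symm
  rw [h]
  exact hc.comp_clm (1 - z • R)

theorem IsSpectralTriple.exists_hasBoundedCommutator [CompleteSpace H] {A : Type*} [Ring A]
    [Algebra ℂ A] {π : A →ₐ[ℂ] (H →L[ℂ] H)} {D : H →ₗ.[ℂ] H} (hD : IsSpectralTriple π D)
    {R : H →L[ℂ] H} (hR : IsResolventAt D 0 R) (a : A) :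
    ∃ C : ℝ, 0 ≤ C ∧ HasBoundedCommutator R (π a) C := by
  obtain ⟨C, hC⟩ := hD.bounded_commutator a
  refine ⟨max C 0, le_max_right _ _, fun y => ?_⟩
  obtain ⟨h, hDy⟩ := hR.exists_mem_domain y
  obtain ⟨h', hle⟩ := hC ⟨R y, h⟩
  rw [hDy] at hle
  refine ⟨D ⟨π a (R y), h'⟩, (hR.apply_apply ⟨π a (R y), h'⟩).symm, hle.trans ?_⟩
  gcongr
  exact le_max_left _ _

end SpectralTriple

end BoxDim


theorem mainTheorem6 {H : Type*} [NormedAddCommGroup H] [InnerProductSpace ℂ H] [CompleteSpace H]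
    {A : Type*} [Ring A] [Algebra ℂ A] (π : A →ₐ[ℂ] (H →L[ℂ] H)) (D : H →ₗ.[ℂ] H)
    (hD : BoxDim.IsSpectralTriple π D)
    (hker : ∀ x : D.domain, D x = 0 → x = 0)
    (h0 : BoxDim.boxDimension D ≠ 0) (htop : BoxDim.boxDimension D ≠ ⊤) :
    let T : H →L[ℂ] H := BoxDim.absNegPow D (BoxDim.boxDimension D).toReal
    (∃ τ : BoxDim.idealGen T →ₗ[ℂ] ℂ, BoxDim.IsSingularTrace T τ ∧
      τ ⟨T, BoxDim.self_mem_idealGen T⟩ = 1) ∧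
    ∀ τ : BoxDim.idealGen T →ₗ[ℂ] ℂ, BoxDim.IsSingularTrace T τ →
      τ ⟨T, BoxDim.self_mem_idealGen T⟩ = 1 →
        BoxDim.IsTraceState π (BoxDim.traceFunctional π T τ) := by
  intro T
  have hR := BoxDim.isResolventAt_inverseOp hD.compact_resolvent hker
  set R := BoxDim.inverseOp D with hRdef
  set d := (BoxDim.boxDimension D).toReal with hd
  have hd0 : 0 < d := ENNReal.toReal_pos h0 htop
  have hsymm := hR.isSymmetric hD.selfAdjoint
  have hsa : IsSelfAdjoint R := ContinuousLinearMap.isSelfAdjoint_iff_isSymmetric.2 hsymm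
  obtain ⟨ι, b, r, hb, hr, hfin⟩ :=
    BoxDim.exists_eigenbasis (hR.isCompactOperator hD.compact_resolvent) hsymm hR.injective
  have hT : ∀ i, T (b i) = ((|r i| ^ d : ℝ) : ℂ) • b i := fun i =>
    BoxDim.abs_rpow_apply_eigenvector hsa hd0 (b.orthonormal.ne_zero i) (hb i)
  have hT0 : 0 ≤ T := CFC.rpow_nonneg
  have hinf : Infinite ι := by
    by_contra hni
    rw [not_infinite_iff_finite] at hni
    have := Fintype.ofFinite ι
    have : FiniteDimensional ℂ H := b.toOrthonormalBasis.toBasis.finiteDimensional_of_finite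
    exact h0 (BoxDim.boxDimension_eq_zero_of_finiteDimensional D)
  constructor
  · obtain ⟨c, hc, hmax⟩ :=
      BoxDim.exists_decreasing_enumeration (ρ := fun i => |r i|) (fun i => abs_pos.2 (hr i)) hfin
    have hmu : ∀ n, BoxDim.mu R n = |r (c n)| := BoxDim.mu_eq b hsa hb hc hmax
    obtain ⟨hup, hlow⟩ := BoxDim.asymptotics_of_boxDimension (D := D)
      (fun n => by rw [← hRdef, hmu]; exact abs_pos.2 (hr _)) h0 htop
    simp only [← hRdef, hmu, ← hd] at hup hlow
    have hpos : ∀ n, 0 < |r (c n)| ^ d := fun n => Real.rpow_pos_of_pos (abs_pos.2 (hr _)) d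
    have hmax' : ∀ n i, (∀ j < n, c j ≠ i) → |r i| ^ d ≤ |r (c n)| ^ d := fun n i h =>
      Real.rpow_le_rpow (abs_nonneg _) (hmax n i h) hd0.le
    have hanti : Antitone fun n => |r (c n)| ^ d := fun n m hnm =>
      hmax' n (c m) fun j hj h => by have := hc h; omega
    exact BoxDim.exists_isSingularTrace_of_sum_Ico_gt (e := fun n => b (c n))
      (b.orthonormal.comp c hc) hpos
      (fun n => BoxDim.norm_sub_sum_le b hT (fun i => by positivity) hc (hmax' n))
      fun C hC => BoxDim.exists_sum_Ico_gt hpos hanti hup hlow hC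
  · intro τ hτ hτ1
    obtain ⟨ψ, hψ⟩ := hτ.exists_continuous hT0
    have hval : ∀ a, BoxDim.traceFunctional π T τ a = ψ (π a) := fun a => (hψ (π a)).symm
    refine ⟨?_, fun a ha => ?_, fun x y => ?_⟩
    · rw [hval, map_one, hψ, BoxDim.traceFunctional_id_apply]
      simpa only [one_mul] using hτ1
    · rw [hval, hψ]
      exact hτ.traceFunctional_nonneg hT0 (ContinuousLinearMap.nonneg_iff_isPositive _ |>.2 ha)
    -- Only the commutator of `D` with `y` matters here; `π x` enters merely as a bounded operator.
    · obtain ⟨C, hC, hx⟩ := hD.exists_hasBoundedCommutator hR y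
      rw [hval, hval, map_mul π, map_mul π]
      exact BoxDim.apply_mul_comm_of_hasBoundedCommutator b hb hr hfin hd0 hT
        (fun z hz => by rw [hψ, hτ.traceFunctional_of_finiteRank hz])
        (fun a v w h => by rw [hψ, hψ, hτ.twist h]) hC hx (π x)
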